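/- Let $V$ be a finite-dimensional real vector space containing a finite reduced crystallographic root system (the roots need not span $V$), with simple roots $\alpha\in\Delta$, coroots $\alpha^\vee\in V^*$, Weyl group $W$ generated by the simple reflections, and weight lattice $\{v\in V:\alpha^\vee(v)\in\mathbb Z\ \text{for all}\ \alpha\in\Delta\}$. Fix $T>0$; a path is a continuous map $\gamma:[0,T]\to V$ with $\gamma(0)=0$. It is dominant if $\alpha^\vee(\gamma(t))\ge 0$ for all $t$ and all $\alpha\in\Delta$. For $\alpha\in\Delta$ the Pitman transform is $\mathcal P_\alpha\gamma(t)=\gamma(t)-\inf_{0\le s\le t}\alpha^\vee(\gamma(s))\,\alpha$. For $x\in\mathbb R$, $E_\alpha^x\gamma$ is the unique path $\eta$ with $\mathcal P_\alpha\eta=\mathcal P_\alpha\gamma$ and $\alpha^\vee(\eta(T))=\alpha^\vee(\gamma(T))+x$ if $-2\alpha^\vee(\gamma(T))+2\inf_{[0,T]}\alpha^\vee(\gamma)\le x\le-2\inf_{[0,T]}\alpha^\vee(\gamma)$, and $E^x_\alpha\gamma=\mathbf 0$ otherwise. The Littelmann operators are $e_\alpha=E_\alpha^2$ and $f_\alpha=E_\alpha^{-2}$,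 $\alpha\in\Delta$, and $B\gamma$ denotes the set of all paths ($\ne\mathbf 0$) obtained from $\gamma$ by applying finite products of Littelmann operators. A path $\gamma$ is called integral if every path $\eta\in B\gamma$ ends in the weight lattice and has $\min_{[0,T]}\alpha^\vee(\eta)\in\mathbb Z$ for every $\alpha\in\Delta$; in other words, the integral paths form the largest class of paths with these two properties that is invariant under the Littelmann operators. Let $w_0$ be the longest element of $W$, let $w_0=s_{\alpha_1}\cdots s_{\alpha_n}$ be any reduced decomposition into simple reflections, and put $\mathcal P_{w_0}=\mathcal P_{\alpha_1}\cdots\mathcal P_{\alpha_n}$. Let $\pi$ be a dominant path whose endpoint $\pi(T)$ lies in the weight lattice. Then for every path $\eta$, $$\eta\in B\pi\iff \eta\ \text{is integral and}\ \mathcal P_{w_0}\eta=\pi .$$ In particular, for every $\eta\in B\pi$, the path $\mathcal P_{w_0}\eta$ ($=\pi$) is the one and only dominant path in $B\eta$. -/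

import Mathlib

/-!
Pitman transforms, generalized Littelmann operators and the Littelmann module for continuous paths
`[0, T] → V` starting at `0`.
-/

namespace PitmanPaths

set_option linter.unusedSectionVars false

/-! ### Paths -/

/-- The time `0` of the interval `[0, T]`. -/
def startTime (T : ℝ) [hT : Fact (0 < T)] : Set.Icc (0 : ℝ) T := ⟨0, le_refl 0, hT.out.le⟩

/-- The time `T` of the interval `[0, T]`. -/
def endTime (T : ℝ) [hT : Fact (0 < T)] : Set.Icc (0 : ℝ) T := ⟨T, hT.out.le, le_refl T⟩

/-- A continuous path `[0, T] → V` with value `0` at time `0`. -/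
@[ext]
structure BasedPath (V : Type*) [Zero V] [TopologicalSpace V] (T : ℝ) [Fact (0 < T)] where
  /-- The underlying continuous map. -/
  toMap : C(Set.Icc (0 : ℝ) T, V)
  map_start : toMap (startTime T) = 0

/-! ### Running infima of continuous functions on `[0, T]` -/

section RunningInf

variable {T : ℝ} [hT : Fact (0 < T)]

theorem start_le (t : Set.Icc (0 : ℝ) T) : startTime T ≤ t := t.2.1

theorem le_end (t : Set.Icc (0 : ℝ) T) : t ≤ endTime T := t.2.2

theorem bddBelow_image {f : Set.Icc (0 : ℝ) T → ℝ} (hf : Continuous f)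
    (s : Set (Set.Icc (0 : ℝ) T)) : BddBelow (f '' s) :=
  ((isCompact_univ.image hf).bddBelow).mono (Set.image_mono (Set.subset_univ s))

theorem continuous_runningInf {f : Set.Icc (0 : ℝ) T → ℝ} (hf : Continuous f) :
    Continuous fun t : Set.Icc (0 : ℝ) T => sInf (f '' Set.Iic t) := by
  have key : ∀ t : Set.Icc (0 : ℝ) T,
      f '' Set.Iic t = (fun s => f (min s t)) '' Set.univ := by
    intro t
    ext y
    constructor
    · rintro ⟨s, hs, rfl⟩
      exact ⟨s, trivial, by simp only [min_eq_left (Set.mem_Iic.mp hs)]⟩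
    · rintro ⟨s, -, rfl⟩
      exact ⟨min s t, min_le_right s t, rfl⟩
  simp_rw [key]
  apply IsCompact.continuous_sInf isCompact_univ
  fun_prop

theorem continuous_futureInf {f : Set.Icc (0 : ℝ) T → ℝ} (hf : Continuous f) :
    Continuous fun t : Set.Icc (0 : ℝ) T => sInf (f '' Set.Ici t) := by
  have key : ∀ t : Set.Icc (0 : ℝ) T,
      f '' Set.Ici t = (fun s => f (max s t)) '' Set.univ := by
    intro t
    ext y
    constructor
    · rintro ⟨s, hs, rfl⟩
      exact ⟨s, trivial, by simp only [max_eq_left (Set.mem_Ici.mp hs)]⟩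
    · rintro ⟨s, -, rfl⟩
      exact ⟨max s t, le_max_right s t, rfl⟩
  simp_rw [key]
  apply IsCompact.continuous_sInf isCompact_univ
  fun_prop

theorem exists_height_eq {f : Set.Icc (0 : ℝ) T → ℝ} (hf : Continuous f)
    {s t : Set.Icc (0 : ℝ) T} (hst : s ≤ t) {y : ℝ} (hy : y ∈ Set.uIcc (f s) (f t)) :
    ∃ u, s ≤ u ∧ u ≤ t ∧ f u = y := by
  have hF : Continuous (Set.IccExtend hT.out.le f) := hf.Icc_extend'
  have hy' : y ∈ Set.uIcc (Set.IccExtend hT.out.le f s) (Set.IccExtend hT.out.le f t) := by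
    simpa using hy
  obtain ⟨u, hu, hu'⟩ := intermediate_value_uIcc hF.continuousOn hy'
  rw [Set.uIcc_of_le (show (s : ℝ) ≤ t from hst)] at hu
  have hmem : u ∈ Set.Icc (0 : ℝ) T := ⟨s.2.1.trans hu.1, hu.2.trans t.2.2⟩
  exact ⟨⟨u, hmem⟩, hu.1, hu.2, by rw [← hu', Set.IccExtend_of_mem _ _ hmem]⟩

theorem Iic_end : Set.Iic (endTime T) = Set.univ :=
  Set.eq_univ_of_forall fun t => le_end t

end RunningInf

section Operators

variable {V : Type*} [AddCommGroup V] [Module ℝ V] [TopologicalSpace V]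
  [IsTopologicalAddGroup V] [ContinuousSMul ℝ V] [T2Space V] [FiniteDimensional ℝ V]
  {T : ℝ} [hT : Fact (0 < T)]

/-- The real function `t ↦ c (γ t)` for a linear form `c`. -/
def height (c : Module.Dual ℝ V) (γ : BasedPath V T) (t : Set.Icc (0 : ℝ) T) : ℝ := c (γ.toMap t)

theorem continuous_height (c : Module.Dual ℝ V) (γ : BasedPath V T) :
    Continuous (height c γ) :=
  (LinearMap.continuous_of_finiteDimensional c).comp γ.toMap.continuous

theorem height_start (c : Module.Dual ℝ V) (γ : BasedPath V T) :
    height c γ (startTime T) = 0 := by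
  simp [height, γ.map_start]

/-- `inf_{0 ≤ t ≤ T} c (γ t)`. -/
noncomputable def minHeight (c : Module.Dual ℝ V) (γ : BasedPath V T) : ℝ :=
  sInf (Set.range (height c γ))

/-- The Pitman transform attached to a vector `α` and a linear form `c` (in the applications
`c α = 2`): `(𝒫 γ)(t) = γ(t) - inf_{0 ≤ s ≤ t} c(γ(s)) α`. -/
noncomputable def pitman (α : V) (c : Module.Dual ℝ V) (γ : BasedPath V T) : BasedPath V T where
  toMap :=
    { toFun := fun t => γ.toMap t - sInf (height c γ '' Set.Iic t) • α
      continuous_toFun := γ.toMap.continuous.sub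
        ((continuous_runningInf (continuous_height c γ)).smul continuous_const) }
  map_start := by
    have h : Set.Iic (startTime T) = {startTime T} := by
      ext t
      exact ⟨fun ht => le_antisymm ht (start_le t), fun ht => le_of_eq ht⟩
    simp [h, height_start, γ.map_start]

/-- The range of the parameter `x` in which the generalized Littelmann operator is nonzero:
`-2 c(γ(T)) + 2 inf c(γ) ≤ x ≤ -2 inf c(γ)`. -/
def InShiftRange (c : Module.Dual ℝ V) (x : ℝ) (γ : BasedPath V T) : Prop :=
  -2 * height c γ (endTime T) + 2 * minHeight c γ ≤ x ∧ x ≤ -2 * minHeight c γ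

/-- The two conditions that characterize the path `η = E^x γ`. -/
def IsShift (α : V) (c : Module.Dual ℝ V) (x : ℝ) (γ η : BasedPath V T) : Prop :=
  pitman α c η = pitman α c γ ∧ height c η (endTime T) = height c γ (endTime T) + x

theorem minHeight_eq (c : Module.Dual ℝ V) (γ : BasedPath V T) :
    minHeight c γ = sInf (height c γ '' Set.Iic (endTime T)) := by
  rw [Iic_end, Set.image_univ, minHeight]

theorem height_pitman {α : V} {c : Module.Dual ℝ V} (hc : c α = 2) (γ : BasedPath V T)
    (t : Set.Icc (0 : ℝ) T) :
    height c (pitman α c γ) t = height c γ t - 2 * sInf (height c γ '' Set.Iic t) := by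
  simp [height, pitman, hc, mul_comm]

theorem runningInf_le (c : Module.Dual ℝ V) (γ : BasedPath V T) {s t : Set.Icc (0 : ℝ) T}
    (h : s ≤ t) : sInf (height c γ '' Set.Iic t) ≤ height c γ s :=
  csInf_le (bddBelow_image (continuous_height c γ) _) ⟨s, h, rfl⟩

theorem runningInf_anti (c : Module.Dual ℝ V) (γ : BasedPath V T) {s t : Set.Icc (0 : ℝ) T}
    (h : s ≤ t) : sInf (height c γ '' Set.Iic t) ≤ sInf (height c γ '' Set.Iic s) :=
  csInf_le_csInf (bddBelow_image (continuous_height c γ) _) ⟨_, s, le_refl s, rfl⟩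
    (Set.image_mono (Set.Iic_subset_Iic.mpr h))

theorem height_pitman_nonneg {α : V} {c : Module.Dual ℝ V} (hc : c α = 2) (γ : BasedPath V T)
    (t : Set.Icc (0 : ℝ) T) : 0 ≤ height c (pitman α c γ) t := by
  rw [height_pitman hc]
  have h1 := runningInf_le c γ (le_refl t)
  have h2 := runningInf_le c γ (start_le t)
  rw [height_start] at h2
  linarith

/-- A path is recovered from its Pitman transform and its minimal height. -/
theorem neg_runningInf_eq {α : V} {c : Module.Dual ℝ V} (hc : c α = 2) (γ : BasedPath V T)
    (t : Set.Icc (0 : ℝ) T) :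
    -sInf (height c γ '' Set.Iic t) =
      min (-minHeight c γ) (sInf (height c (pitman α c γ) '' Set.Ici t)) := by
  have hf := continuous_height c γ
  apply le_antisymm
  · apply le_min
    · rw [minHeight_eq]
      exact neg_le_neg (runningInf_anti c γ (le_end t))
    · apply le_csInf (Set.nonempty_Ici.image _)
      rintro _ ⟨s, hs, rfl⟩
      rw [height_pitman hc]
      have h1 := runningInf_le c γ (le_refl s)
      have h2 := runningInf_anti c γ (Set.mem_Ici.mp hs)
      linarith
  · set m := sInf (height c γ '' Set.Iic t) with hm
    by_cases hlast : ∀ s, m ≤ height c γ s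
    · apply min_le_of_left_le
      have : m ≤ minHeight c γ := 
        le_csInf ⟨_, t, rfl⟩ (by rintro _ ⟨s, rfl⟩; exact hlast s)
      linarith
    · push Not at hlast
      obtain ⟨v, hv⟩ := hlast
      have htv : t ≤ v := by
        by_contra hlt
        exact absurd (runningInf_le c γ (not_le.mp hlt).le) (not_le.mpr hv)
      have hmt : m ≤ height c γ t := runningInf_le c γ (le_refl t)
      -- the first time after `t` at which the height equals `m`
      have hne : (Set.Ici t ∩ height c γ ⁻¹' {m}).Nonempty := by
        obtain ⟨u, hu, -, hu'⟩ :=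
          exists_height_eq hf htv (Set.mem_uIcc.mpr (Or.inr ⟨hv.le, hmt⟩))
        exact ⟨u, hu, hu'⟩
      obtain ⟨u, ⟨htu, hu⟩, hmin⟩ := (IsClosed.isCompact
        (isClosed_Ici.inter (isClosed_singleton.preimage hf))).exists_isLeast hne
      have hbetween : ∀ s ≤ u, m ≤ height c γ s := by
        intro s hs
        by_contra hlt
        push Not at hlt
        have hts : t ≤ s := by
          by_contra h
          exact absurd (runningInf_le c γ (not_le.mp h).le) (not_le.mpr hlt)
        obtain ⟨r, hr1, hr2, hr'⟩ :=
          exists_height_eq hf hts (Set.mem_uIcc.mpr (Or.inr ⟨hlt.le, hmt⟩))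
        have hur : u ≤ r := hmin ⟨hr1, hr'⟩
        have : s = u := le_antisymm hs (hur.trans hr2)
        rw [this, hu] at hlt
        exact lt_irrefl _ hlt
      have hrun : sInf (height c γ '' Set.Iic u) = m := by
        apply le_antisymm
        · exact runningInf_anti c γ htu
        · apply le_csInf (Set.nonempty_Iic.image _)
          rintro _ ⟨s, hs, rfl⟩
          exact hbetween s hs
      apply min_le_of_right_le
      have h1 : sInf (height c (pitman α c γ) '' Set.Ici t) ≤ height c (pitman α c γ) u :=
        csInf_le (bddBelow_image (continuous_height c _) _) ⟨u, htu, rfl⟩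
      rw [height_pitman hc, hrun, hu] at h1
      linarith

/-- Existence and uniqueness of the path in the definition of `E^x`. -/
theorem existsUnique_isShift {α : V} {c : Module.Dual ℝ V} (hc : c α = 2) {x : ℝ}
    {γ : BasedPath V T} (hx : InShiftRange c x γ) : ∃! η, IsShift α c x γ η := by
  set g := pitman α c γ with hg
  set h := height c g with hh
  have hcont : Continuous h := continuous_height c g
  have hnn : ∀ t, 0 ≤ h t := height_pitman_nonneg hc γ
  have hend : h (endTime T) = height c γ (endTime T) - 2 * minHeight c γ := by
    rw [hh, height_pitman hc, minHeight_eq]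
  set y := -minHeight c γ - x / 2 with hy
  have hy0 : 0 ≤ y := by have := hx.2; linarith
  have hy1 : y ≤ h (endTime T) := by have := hx.1; rw [hend]; linarith
  set k : Set.Icc (0 : ℝ) T → ℝ := fun t => min y (sInf (h '' Set.Ici t)) with hk
  have hkcont : Continuous k := continuous_const.min (continuous_futureInf hcont)
  have hkmono : ∀ {s t}, s ≤ t → k s ≤ k t := by
    intro s t hst
    exact min_le_min_left _ (csInf_le_csInf (bddBelow_image hcont _) ⟨_, t, le_refl t, rfl⟩
      (Set.image_mono (Set.Ici_subset_Ici.mpr hst)))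
  have hkle : ∀ t, k t ≤ h t := fun t =>
    (min_le_right _ _).trans (csInf_le (bddBelow_image hcont _) ⟨t, le_refl t, rfl⟩)
  have hk0 : ∀ t, 0 ≤ k t := fun t => le_min hy0
    (le_csInf (Set.nonempty_Ici.image _) (by rintro _ ⟨s, -, rfl⟩; exact hnn s))
  have hstart : h (startTime T) = 0 := height_start c g
  have hkend : k (endTime T) = y := by
    apply min_eq_left
    apply le_csInf (Set.nonempty_Ici.image _)
    rintro _ ⟨s, hs, rfl⟩
    rw [le_antisymm (le_end s) hs]
    exact hy1
  let η : BasedPath V T :=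
    { toMap := ⟨fun t => g.toMap t - k t • α,
        g.toMap.continuous.sub (hkcont.smul continuous_const)⟩
      map_start := by
        have : k (startTime T) = 0 := le_antisymm ((hkle _).trans_eq hstart) (hk0 _)
        simp [this, g.map_start] }
  have hη : ∀ t, height c η t = h t - 2 * k t := by
    intro t
    simp [height, η, hc, hh, mul_comm]
  have hrun : ∀ t, sInf (height c η '' Set.Iic t) = -k t := by
    intro t
    apply le_antisymm
    · -- the last time before `t` at which `h` equals `k t`
      have hne : (Set.Iic t ∩ h ⁻¹' {k t}).Nonempty := by
        obtain ⟨u, -, hu, hu'⟩ := exists_height_eq hcont (start_le t)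
          (Set.mem_uIcc.mpr (Or.inl ⟨by rw [hstart]; exact hk0 t, hkle t⟩))
        exact ⟨u, hu, hu'⟩
      obtain ⟨u, ⟨hut, hu⟩, hmax⟩ := (IsClosed.isCompact
        (isClosed_Iic.inter (isClosed_singleton.preimage hcont))).exists_isGreatest hne
      have hu : h u = k t := hu
      have hku : k t ≤ k u := by
        apply le_min (min_le_left _ _)
        apply le_csInf (Set.nonempty_Ici.image _)
        rintro _ ⟨s, hs, rfl⟩
        by_contra hlt
        push Not at hlt
        rcases le_total t s with hts | hst
        · exact absurd ((min_le_right _ _).trans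
            (csInf_le (bddBelow_image hcont (Set.Ici t)) ⟨s, hts, rfl⟩)) (not_le.mpr hlt)
        · obtain ⟨r, hr1, hr2, hr'⟩ := exists_height_eq hcont hst
            (Set.mem_uIcc.mpr (Or.inl ⟨hlt.le, hkle t⟩))
          have hru : r ≤ u := hmax ⟨hr2, hr'⟩
          have : s = u := le_antisymm (hr1.trans hru) hs
          rw [this, hu] at hlt
          exact lt_irrefl _ hlt
      have := runningInf_le c η hut
      rw [hη u, hu, le_antisymm (hkmono hut) hku] at this
      linarith
    · apply le_csInf (Set.nonempty_Iic.image _)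
      rintro _ ⟨s, hs, rfl⟩
      rw [hη s]
      have h1 := hkle s
      have h2 := hkmono (Set.mem_Iic.mp hs)
      linarith
  refine ⟨η, ⟨?_, ?_⟩, ?_⟩
  · ext t
    change η.toMap t - sInf (height c η '' Set.Iic t) • α = g.toMap t
    rw [hrun t]
    simp [η]
  · rw [hη, hkend, hend, hy]
    ring
  · rintro μ ⟨hμ1, hμ2⟩
    have hμend := height_pitman hc μ (endTime T)
    rw [hμ1, ← minHeight_eq] at hμend
    have hyμ : -minHeight c μ = y := by
      have : h (endTime T) = height c μ (endTime T) - 2 * minHeight c μ := hμend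
      rw [hend, hμ2] at this
      rw [hy]
      linarith
    ext t
    have h1 := neg_runningInf_eq hc μ t
    rw [hμ1, hyμ] at h1
    have h2 : g.toMap t = μ.toMap t - sInf (height c μ '' Set.Iic t) • α :=
      (congrArg (fun p : BasedPath V T => p.toMap t) hμ1).symm
    change μ.toMap t = g.toMap t - k t • α
    have h3 : k t = -sInf (height c μ '' Set.Iic t) := h1.symm
    rw [h2, h3]
    simp

open Classical in
/-- The generalized Littelmann operator `E^x`: `E^x γ` is the unique path `η` with
`𝒫 η = 𝒫 γ` and `c(η(T)) = c(γ(T)) + x` if `x` lies in the admissible range; otherwise it is the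
symbol `𝟎`, here `none`. -/
noncomputable def genLittelmann {α : V} {c : Module.Dual ℝ V} (hc : c α = 2) (x : ℝ)
    (γ : BasedPath V T) : Option (BasedPath V T) :=
  if hx : InShiftRange c x γ then some (existsUnique_isShift hc hx).choose else none

end Operators

/-! ### Root systems -/

section Roots

variable {ι V N : Type*} [AddCommGroup V] [Module ℝ V] [AddCommGroup N] [Module ℝ N]
  {P : RootPairing ι ℝ V N} (b : P.Base)

/-- The element `s_1 ⋯ s_n` of the Weyl group given by a word in the simple roots. -/
noncomputable def wordProd (l : List b.support) : P.weylGroup :=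
  (l.map fun i => RootPairing.weylGroup.ofIdx P i).prod

/-- `l` is a reduced decomposition of `w` into simple reflections. -/
def IsReducedWord (l : List b.support) (w : P.weylGroup) : Prop :=
  wordProd b l = w ∧ ∀ l' : List b.support, wordProd b l' = w → l.length ≤ l'.length

/-- The length of a Weyl group element with respect to the simple reflections. -/
noncomputable def weylLength (w : P.weylGroup) : ℕ :=
  sInf {n | ∃ l : List b.support, wordProd b l = w ∧ l.length = n}

/-- `w` is the longest element of the Weyl group. -/
def IsLongest (w : P.weylGroup) : Prop :=
  ∀ w' : P.weylGroup, weylLength b w' ≤ weylLength b w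

/-- The weight lattice: the vectors on which all simple coroots are integral. -/
def weightLattice : Set V :=
  {v | ∀ i ∈ b.support, ∃ n : ℤ, P.coroot' i v = n}

variable [TopologicalSpace V] [IsTopologicalAddGroup V] [ContinuousSMul ℝ V] [T2Space V]
  [FiniteDimensional ℝ V] {T : ℝ} [hT : Fact (0 < T)]

/-- The Pitman transform of a simple root. -/
noncomputable def simplePitman (i : b.support) : BasedPath V T → BasedPath V T :=
  pitman (P.root i) (P.coroot' i)

/-- `𝒫_{s_1} ∘ ⋯ ∘ 𝒫_{s_n}` for a word `s_1, …, s_n`; for a reduced decomposition of `w` this is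
the operator `𝒫_w`. -/
noncomputable def pitmanWord (l : List b.support) (γ : BasedPath V T) : BasedPath V T :=
  l.foldr (simplePitman b) γ

theorem coroot'_root_self (i : ι) : P.coroot' i (P.root i) = 2 := by
  simp

/-- The Littelmann operator `e_α = E_α^2` of a simple root. -/
noncomputable def littelmannE (i : b.support) : BasedPath V T → Option (BasedPath V T) :=
  genLittelmann (coroot'_root_self (P := P) i) 2

/-- The Littelmann operator `f_α = E_α^{-2}` of a simple root. -/
noncomputable def littelmannF (i : b.support) : BasedPath V T → Option (BasedPath V T) :=
  genLittelmann (coroot'_root_self (P := P) i) (-2)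

/-- `ν` is a nonzero image of `μ` under a single Littelmann operator. -/
def LittelmannStep (μ ν : BasedPath V T) : Prop :=
  ∃ i : b.support, littelmannE b i μ = some ν ∨ littelmannF b i μ = some ν

/-- The set `Bγ` of all nonzero paths obtained from `γ` by products of Littelmann operators. -/
def littelmannModule (γ : BasedPath V T) : Set (BasedPath V T) :=
  {η | Relation.ReflTransGen (LittelmannStep b) γ η}

/-- `γ` takes its values in the closed Weyl chamber. -/
def IsDominant (γ : BasedPath V T) : Prop :=
  ∀ i ∈ b.support, ∀ t, 0 ≤ P.coroot' i (γ.toMap t)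

/-- The endpoint of `γ` is a weight and the minima of its simple coroots are integers. -/
def HasIntegralMinima (γ : BasedPath V T) : Prop :=
  γ.toMap (endTime T) ∈ weightLattice b ∧
    ∀ i ∈ b.support, ∃ n : ℤ, minHeight (P.coroot' i) γ = n

/-- Integral paths: the largest class of paths with integral endpoint and integral minima that is
invariant under the Littelmann operators. -/
def IsIntegralPath (γ : BasedPath V T) : Prop :=
  ∀ η ∈ littelmannModule b γ, HasIntegralMinima b η

end Roots

end PitmanPaths

/-! Every simple root $\alpha_i$ is the last letter of some reduced word of $w_0$. Once $\mathcal
P_{w_0}$ is known not to depend on the reduced word, it factors as $\mathcal P'\circ\mathcal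
P_{\alpha_i}$, and since $e_i$ and $f_i$ preserve $\mathcal P_{\alpha_i}\eta$ by definition, it is
constant on $B\pi$. Its value there is $\pi$, because Pitman transforms fix dominant paths.

Integrality is carried by the string parameters: the minima met while the letters of a reduced word
of $w_0$ act in turn. For $\pi$ they all vanish. Whether they are all integers is again independent
of the reduced word, and with a word ending in $\alpha_i$ the operators $e_i$, $f_i$ change only the
parameter of that letter, by $\pm1$. So paths in $B\pi$ have integer parameters, hence integral
minima, and endpoints in $\pi(T)$ plus the root lattice. Conversely, for integral $\eta$ the path
$\mathcal P_{\alpha_i}\eta$ is a power of $e_i$ applied to $\eta$, so $\mathcal P_{w_0}\eta\in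
B\eta$; membership is symmetric because $e_i$ and $f_i$ invert each other.

Independence of the word reduces by Matsumoto's theorem (`IsReducedWord.rel`) to the braid relations
in rank two. Type $A_2$ rests on two identities of running infima, `runInf_pitman_identity` for the
paths and `runInf_add_runInf` for the parameters. Types $B_2$ and $G_2$ are folded from $A_3$ and
$D_4$, where an explicit chain of commutations and $A_2$ relations suffices
(`wordEquiv_altWord_bool`). -/

namespace PitmanPaths

set_option linter.unusedSectionVars false

/-! ### Identities between running infima -/

section RunInf

variable {T : ℝ} [hT : Fact (0 < T)] {f g : Set.Icc (0 : ℝ) T → ℝ}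

/-- The running infimum `t ↦ inf_{s ≤ t} f s`. -/
noncomputable def runInf (f : Set.Icc (0 : ℝ) T → ℝ) (t : Set.Icc (0 : ℝ) T) : ℝ :=
  sInf (f '' Set.Iic t)

theorem continuous_runInf (hf : Continuous f) : Continuous (runInf f) :=
  continuous_runningInf hf

theorem runInf_le (hf : Continuous f) {s t : Set.Icc (0 : ℝ) T} (h : s ≤ t) : runInf f t ≤ f s :=
  csInf_le (bddBelow_image hf _) ⟨s, h, rfl⟩

theorem le_runInf {a : ℝ} {t : Set.Icc (0 : ℝ) T} (h : ∀ s ≤ t, a ≤ f s) : a ≤ runInf f t :=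
  le_csInf (Set.nonempty_Iic.image _) (by rintro _ ⟨s, hs, rfl⟩; exact h s hs)

theorem runInf_anti (hf : Continuous f) {s t : Set.Icc (0 : ℝ) T} (h : s ≤ t) :
    runInf f t ≤ runInf f s :=
  le_runInf fun _ hr => runInf_le hf (hr.trans h)

theorem exists_eq_runInf (hf : Continuous f) (t : Set.Icc (0 : ℝ) T) :
    ∃ s ≤ t, f s = runInf f t := by
  obtain ⟨s, hs, h⟩ := (isClosed_Iic.isCompact (X := Set.Icc (0 : ℝ) T)).exists_isMinOn
    (Set.nonempty_Iic (a := t)) hf.continuousOn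
  exact ⟨s, hs, le_antisymm (le_runInf fun r hr => h hr) (runInf_le hf hs)⟩

/-- If the running infimum decreases between `u` and `t`, then the level `runInf f u` is visited
for the first time after `u` at a time where it is the running infimum. -/
theorem exists_eq_of_runInf_lt (hf : Continuous f) {u t : Set.Icc (0 : ℝ) T}
    (h : runInf f t < runInf f u) :
    ∃ s, u ≤ s ∧ s ≤ t ∧ f s = runInf f u ∧ runInf f s = runInf f u := by
  obtain ⟨v, hvt, hv⟩ := exists_eq_runInf hf t
  have huv : u ≤ v := by
    by_contra hlt
    have := runInf_le hf (not_le.mp hlt).le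
    linarith
  have hne : (Set.Icc u v ∩ f ⁻¹' {runInf f u}).Nonempty := by
    obtain ⟨r, h1, h2, h3⟩ := exists_height_eq hf huv
      (Set.mem_uIcc.mpr (Or.inr ⟨hv.trans_lt h |>.le, runInf_le hf le_rfl⟩))
    exact ⟨r, ⟨h1, h2⟩, h3⟩
  obtain ⟨s, ⟨⟨hus, hsv⟩, hs⟩, hmin⟩ := (IsClosed.isCompact
    (isClosed_Icc.inter (isClosed_singleton.preimage hf))).exists_isLeast hne
  refine ⟨s, hus, hsv.trans hvt, hs, le_antisymm (runInf_anti hf hus) (le_runInf fun r hr => ?_)⟩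
  rcases le_total r u with hru | hur
  · exact runInf_le hf hru
  by_contra hlt
  obtain ⟨q, h1, h2, h3⟩ := exists_height_eq hf hur
    (Set.mem_uIcc.mpr (Or.inr ⟨(not_le.mp hlt).le, runInf_le hf le_rfl⟩))
  have hsq : s ≤ q := hmin ⟨⟨h1, h2.trans (hr.trans hsv)⟩, h3⟩
  have : r = q := le_antisymm (hr.trans hsq) h2
  rw [this, h3] at hlt
  exact hlt le_rfl

/-- Write $F$ for the running infimum of $f$, and let $u\le s\le t$ be times attaining the nested
infima of one side. If $F$ does not drop between $u$ and $t$, it is constant there and the $F$-terms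
cancel at $s$. If it drops, $s$ is replaced by a time $r\ge u$ with $f(r)=F(r)$. -/
theorem runInf_pitman_identity (hf : Continuous f) (hg : Continuous g)
    (t : Set.Icc (0 : ℝ) T) :
    runInf f t + runInf (fun s => f s - 2 * runInf f s + runInf (fun u => g u + runInf f u) s) t =
      runInf (fun s => f s + runInf g s) t := by
  have hF := continuous_runInf hf
  have hG := continuous_runInf hg
  have hgF : Continuous fun u => g u + runInf f u := by fun_prop
  have hGF := continuous_runInf hgF
  have h1 : Continuous fun s => f s - 2 * runInf f s + runInf (fun u => g u + runInf f u) s := by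
    fun_prop
  have h2 : Continuous fun s => f s + runInf g s := by fun_prop
  apply le_antisymm
  · obtain ⟨s, hst, hs⟩ := exists_eq_runInf h2 t
    obtain ⟨u, hus, hu⟩ := exists_eq_runInf hg s
    rw [← hs]
    rw [← hu]
    have key : ∀ r, u ≤ r → r ≤ t →
        runInf (fun s => f s - 2 * runInf f s + runInf (fun u => g u + runInf f u) s) t ≤
          f r - 2 * runInf f r + (g u + runInf f u) := fun r hur hrt =>
      (runInf_le h1 hrt).trans (by
        have := runInf_le hgF hur
        linarith)
    rcases (runInf_anti hf (hus.trans hst)).lt_or_eq with hlt | heq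
    -- At this $r$ both $f$ and $F$ equal $F(u)$, so $f-2F+g(u)+F(u)$ collapses to $g(u)$.
    · obtain ⟨r, hur, hrt, e1, e2⟩ := exists_eq_of_runInf_lt hf hlt
      have := key r hur hrt
      have := runInf_le hf hst
      linarith
    · have := key s hus hst
      have h3 := runInf_anti hf hus
      have h4 := runInf_anti hf hst
      linarith
  · obtain ⟨s, hst, hs⟩ := exists_eq_runInf h1 t
    obtain ⟨u, hus, hu⟩ := exists_eq_runInf hgF s
    rw [← hs]
    rw [← hu]
    have key : ∀ r, u ≤ r → r ≤ t → runInf (fun s => f s + runInf g s) t ≤ f r + g u :=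
      fun r hur hrt => (runInf_le h2 hrt).trans (by
        have := runInf_le hg hur
        linarith)
    have h3 := runInf_anti hf hus
    have h4 := runInf_anti hf hst
    have h5 := runInf_le hf (le_refl s)
    rcases (runInf_anti hf (hus.trans hst)).lt_or_eq with hlt | heq
    · obtain ⟨r, hrt, hr⟩ := exists_eq_runInf hf t
      have hur : u ≤ r := by
        by_contra h
        have := runInf_le hf (not_le.mp h).le
        linarith
      have := key r hur hrt
      linarith
    · have := key s hus hst
      linarith

/-- The two infima are attained at independent times, and the order of these times decides which
term of the minimum is reached. -/
theorem runInf_add_runInf (hf : Continuous f) (hg : Continuous g) (t : Set.Icc (0 : ℝ) T) :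
    runInf f t + runInf g t =
      min (runInf (fun s => g s + runInf f s) t) (runInf (fun s => f s + runInf g s) t) := by
  have hF := continuous_runInf hf
  have hG := continuous_runInf hg
  have h1 : Continuous fun u => g u + runInf f u := by fun_prop
  have h2 : Continuous fun s => f s + runInf g s := by fun_prop
  apply le_antisymm
  · refine le_min (le_runInf fun s hs => ?_) (le_runInf fun s hs => ?_)
    · have := runInf_anti hf hs
      have := runInf_le hg hs
      linarith
    · have := runInf_anti hg hs
      have := runInf_le hf hs
      linarith
  · obtain ⟨s, hs, es⟩ := exists_eq_runInf hf t
    obtain ⟨u, hu, eu⟩ := exists_eq_runInf hg t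
    rcases le_total s u with h | h
    · refine (min_le_left _ _).trans ((runInf_le h1 hu).trans ?_)
      have := runInf_le hf h
      linarith
    · refine (min_le_right _ _).trans ((runInf_le h2 hs).trans ?_)
      have := runInf_le hg h
      linarith

end RunInf

/-! ### Words of Pitman transforms and their string parameters -/

section Words

variable {V : Type*} [AddCommGroup V] [Module ℝ V] [TopologicalSpace V]
  [IsTopologicalAddGroup V] [ContinuousSMul ℝ V] [T2Space V] [FiniteDimensional ℝ V]
  {T : ℝ} [hT : Fact (0 < T)] {J : Type*}

theorem pitman_apply (α : V) (c : Module.Dual ℝ V) (γ : BasedPath V T) (t : Set.Icc (0 : ℝ) T) :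
    (pitman α c γ).toMap t = γ.toMap t - runInf (height c γ) t • α := rfl

theorem height_pitman_eq (d : Module.Dual ℝ V) (α : V) (c : Module.Dual ℝ V) (γ : BasedPath V T) :
    height d (pitman α c γ) = fun t => height d γ t - runInf (height c γ) t * d α := by
  funext t
  simp [height, pitman_apply]

theorem minHeight_eq_runInf (c : Module.Dual ℝ V) (γ : BasedPath V T) :
    minHeight c γ = runInf (height c γ) (endTime T) :=
  minHeight_eq c γ

/-- The composition of the Pitman transforms of the letters of a word, the last letter acting
first. -/
noncomputable def pitWord (α : J → V) (c : J → Module.Dual ℝ V) (l : List J) (γ : BasedPath V T) :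
    BasedPath V T :=
  l.foldr (fun j => pitman (α j) (c j)) γ

/-- The string parameters of `γ` along a word are integers. -/
def IntWord (α : J → V) (c : J → Module.Dual ℝ V) : List J → BasedPath V T → Prop
  | [], _ => True
  | j :: l, γ => (∃ n : ℤ, minHeight (c j) (pitWord α c l γ) = n) ∧ IntWord α c l γ

/-- Two words define the same composition of Pitman transforms, and the string parameters along
one are integers if and only if the string parameters along the other are. -/
def WordEquiv (T : ℝ) [Fact (0 < T)] (α : J → V) (c : J → Module.Dual ℝ V) (l l' : List J) : Prop :=
  ∀ γ : BasedPath V T, pitWord α c l γ = pitWord α c l' γ ∧ (IntWord α c l γ ↔ IntWord α c l' γ)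

variable {α : J → V} {c : J → Module.Dual ℝ V}

@[simp] theorem pitWord_nil (γ : BasedPath V T) : pitWord α c [] γ = γ := rfl

@[simp] theorem pitWord_cons (j : J) (l : List J) (γ : BasedPath V T) :
    pitWord α c (j :: l) γ = pitman (α j) (c j) (pitWord α c l γ) := rfl

theorem pitWord_append (l l' : List J) (γ : BasedPath V T) :
    pitWord α c (l ++ l') γ = pitWord α c l (pitWord α c l' γ) := by
  simp [pitWord, List.foldr_append]

@[simp] theorem intWord_nil (γ : BasedPath V T) : IntWord α c [] γ := trivial

@[simp] theorem intWord_cons (j : J) (l : List J) (γ : BasedPath V T) :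
    IntWord α c (j :: l) γ ↔
      (∃ n : ℤ, minHeight (c j) (pitWord α c l γ) = n) ∧ IntWord α c l γ := Iff.rfl

theorem intWord_append (l l' : List J) (γ : BasedPath V T) :
    IntWord α c (l ++ l') γ ↔ IntWord α c l (pitWord α c l' γ) ∧ IntWord α c l' γ := by
  induction l with
  | nil => simp
  | cons j l ih => simp [ih, pitWord_append, and_assoc]

theorem pitWord_map {K : Type*} (φ : K → J) (l : List K) (γ : BasedPath V T) :
    pitWord α c (l.map φ) γ = pitWord (α ∘ φ) (c ∘ φ) l γ := by
  simp [pitWord, List.foldr_map]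

theorem intWord_map {K : Type*} (φ : K → J) (l : List K) (γ : BasedPath V T) :
    IntWord α c (l.map φ) γ ↔ IntWord (α ∘ φ) (c ∘ φ) l γ := by
  induction l with
  | nil => simp
  | cons k l ih => simp [ih, pitWord_map]

/-! ### Equivalence of words; the braid relations of length two and three. -/

namespace WordEquiv

theorem refl (l : List J) : WordEquiv T α c l l := fun _ => ⟨rfl, Iff.rfl⟩

theorem symm {l l' : List J} (h : WordEquiv T α c l l') : WordEquiv T α c l' l :=
  fun γ => ⟨(h γ).1.symm, (h γ).2.symm⟩

theorem trans {l l' l'' : List J} (h : WordEquiv T α c l l') (h' : WordEquiv T α c l' l'') :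
    WordEquiv T α c l l'' :=
  fun γ => ⟨(h γ).1.trans (h' γ).1, (h γ).2.trans (h' γ).2⟩

theorem append_left {l l' : List J} (h : WordEquiv T α c l l') (p : List J) :
    WordEquiv T α c (p ++ l) (p ++ l') := fun γ => by
  simp only [pitWord_append, intWord_append, (h γ).1, (h γ).2, and_self]

theorem append_right {l l' : List J} (h : WordEquiv T α c l l') (q : List J) :
    WordEquiv T α c (l ++ q) (l' ++ q) := fun γ => by
  simp only [pitWord_append, intWord_append, (h _).1, (h _).2, and_self]

theorem map {K : Type*} (φ : K → J) {l l' : List K} (h : WordEquiv T (α ∘ φ) (c ∘ φ) l l') :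
    WordEquiv T α c (l.map φ) (l'.map φ) := fun γ => by
  simp only [pitWord_map, intWord_map, (h γ).1, (h γ).2, and_self]

theorem swap {i j : J} (hij : c i (α j) = 0) (hji : c j (α i) = 0) :
    WordEquiv T α c [i, j] [j, i] := by
  intro γ
  have h1 : height (c i) (pitman (α j) (c j) γ) = height (c i) γ := by
    simp [height_pitman_eq, hij]
  have h2 : height (c j) (pitman (α i) (c i) γ) = height (c j) γ := by
    simp [height_pitman_eq, hji]
  refine ⟨?_, ?_⟩
  · ext t
    simp only [pitWord_cons, pitWord_nil, pitman_apply, h1, h2]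
    abel
  · simp only [intWord_cons, pitWord_cons, pitWord_nil, minHeight_eq_runInf, h1, h2, intWord_nil,
      and_true]
    exact and_comm

/-- The string parameters along the two words of a braid relation of length three. -/
theorem heights_of_braid {i j : J} (hi : c i (α i) = 2) (hij : c i (α j) = -1)
    (hji : c j (α i) = -1) (γ : BasedPath V T) :
    height (c j) (pitman (α i) (c i) γ) =
        (fun t => height (c j) γ t + runInf (height (c i) γ) t) ∧
      runInf (height (c i) (pitman (α j) (c j) (pitman (α i) (c i) γ))) = fun t =>
        runInf (fun s => height (c i) γ s + runInf (height (c j) γ) s) t -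
          runInf (height (c i) γ) t := by
  have h1 : height (c j) (pitman (α i) (c i) γ) =
      fun t => height (c j) γ t + runInf (height (c i) γ) t := by
    simp [height_pitman_eq, hji]
  refine ⟨h1, ?_⟩
  funext t
  rw [← runInf_pitman_identity (continuous_height (c i) γ) (continuous_height (c j) γ) t,
    add_sub_cancel_left, height_pitman_eq (c i) (α j), height_pitman_eq (c i) (α i), h1, hi, hij]
  congr 1
  funext s
  ring

/-- In order of application the parameters are $F,\ FG,\ GF-F$ along $iji$ and $G,\ GF,\ FG-G$ along
$jij$. Since $F+G=\min(FG,GF)$, each triple is an integral piecewise linear function of the other.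
-/
theorem intWord_of_braid {i j : J} (hi : c i (α i) = 2) (hj : c j (α j) = 2)
    (hij : c i (α j) = -1) (hji : c j (α i) = -1) {γ : BasedPath V T}
    (h : IntWord α c [i, j, i] γ) : IntWord α c [j, i, j] γ := by
  obtain ⟨e1, e2⟩ := heights_of_braid hi hij hji γ
  obtain ⟨e3, e4⟩ := heights_of_braid hj hji hij γ
  have e5 := runInf_add_runInf (continuous_height (c i) γ) (continuous_height (c j) γ) (endTime T)
  simp only [intWord_cons, pitWord_cons, pitWord_nil, minHeight_eq_runInf, intWord_nil,
    and_true, e1, e2, e3, e4] at h ⊢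
  obtain ⟨⟨n3, h3⟩, ⟨n2, h2⟩, n1, h1⟩ := h
  set F := runInf (height (c i) γ) (endTime T)
  set G := runInf (height (c j) γ) (endTime T)
  set FG := runInf (fun t => height (c j) γ t + runInf (height (c i) γ) t) (endTime T)
  set GF := runInf (fun t => height (c i) γ t + runInf (height (c j) γ) t) (endTime T)
  have hGF : GF = ((n3 + n1 : ℤ) : ℝ) := by push_cast; linarith
  have hG : G = ((min n2 (n3 + n1) - n1 : ℤ) : ℝ) := by
    rw [h1, h2, hGF] at e5
    rw [Int.cast_sub, Int.cast_min]
    linarith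
  refine ⟨⟨n2 - (min n2 (n3 + n1) - n1), ?_⟩, ⟨_, hGF⟩, ⟨_, hG⟩⟩
  rw [hG, h2]
  push_cast
  ring

/-- In the notation of `intWord_of_braid`, now with running infima, the terms in $F$ (or $G$) cancel
and both words subtract $FG\,\alpha_j+GF\,\alpha_i$. -/
theorem braid {i j : J} (hi : c i (α i) = 2) (hj : c j (α j) = 2)
    (hij : c i (α j) = -1) (hji : c j (α i) = -1) :
    WordEquiv T α c [i, j, i] [j, i, j] := by
  intro γ
  refine ⟨?_, intWord_of_braid hi hj hij hji, intWord_of_braid hj hi hji hij⟩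
  obtain ⟨e1, e2⟩ := heights_of_braid hi hij hji γ
  obtain ⟨e3, e4⟩ := heights_of_braid hj hji hij γ
  ext t
  simp only [pitWord_cons, pitWord_nil, pitman_apply, e1, e2, e3, e4]
  module

end WordEquiv

end Words

/-! ### Star-shaped simply laced diagrams -/

section Star

variable {k : ℕ} {T : ℝ} [hT : Fact (0 < T)]

/-- The Cartan matrix of the star with centre `0` and `k` leaves. -/
def starCartan (i j : Fin (k + 1)) : ℤ :=
  if i = j then 2 else if i = 0 ∨ j = 0 then -1 else 0

/-- The simple roots of the star, in the coordinates given by the simple coroots. -/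
def starRoot (j : Fin (k + 1)) : Fin (k + 1) → ℝ := fun i => starCartan i j

/-- The simple coroots of the star. -/
def starCoroot (i : Fin (k + 1)) : Module.Dual ℝ (Fin (k + 1) → ℝ) := LinearMap.proj i

theorem starCoroot_starRoot (i j : Fin (k + 1)) :
    starCoroot i (starRoot j) = starCartan i j := rfl

/-- The commutation or braid relation, if there is one, at a given position of a word in the nodes
of the star. -/
def starMove : ℕ → List (Fin (k + 1)) → List (Fin (k + 1))
  | n + 1, i :: l => i :: starMove n l
  | 0, i :: j :: l =>
    if i = j then i :: j :: l
    else if i ≠ 0 ∧ j ≠ 0 then j :: i :: l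
    else match l with
      | [] => [i, j]
      | h :: l => if h = i then j :: i :: j :: l else i :: j :: h :: l
  | 0, l => l
  | _ + 1, [] => []

theorem wordEquiv_starMove (n : ℕ) (l : List (Fin (k + 1))) :
    WordEquiv T starRoot starCoroot l (starMove n l) := by
  induction n generalizing l with
  | succ n ih =>
    cases l with
    | nil => exact WordEquiv.refl _
    | cons i l => exact (ih l).append_left [i]
  | zero =>
    match l with
    | [] => exact WordEquiv.refl _
    | [_] => exact WordEquiv.refl _
    | i :: j :: l =>
      unfold starMove
      split_ifs with h1 h2
      · exact WordEquiv.refl _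
      · refine (WordEquiv.swap ?_ ?_).append_right l
        · simp [starCoroot_starRoot, starCartan, h1, h2.1, h2.2]
        · simp [starCoroot_starRoot, starCartan, Ne.symm h1, h2.1, h2.2]
      · cases l with
        | nil => exact WordEquiv.refl _
        | cons h l =>
          dsimp only
          split_ifs with h3
          · subst h3
            have h4 : h = 0 ∨ j = 0 := by tauto
            refine (WordEquiv.braid ?_ ?_ ?_ ?_).append_right l
            · simp [starCoroot_starRoot, starCartan]
            · simp [starCoroot_starRoot, starCartan]
            · simp [starCoroot_starRoot, starCartan, h1, h4]
            · simp [starCoroot_starRoot, starCartan, Ne.symm h1, h4.symm]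
          · exact WordEquiv.refl _

theorem wordEquiv_foldl_starMove (ns : List ℕ) (l : List (Fin (k + 1))) :
    WordEquiv T starRoot starCoroot l (ns.foldl (fun l n => starMove n l) l) := by
  induction ns generalizing l with
  | nil => exact WordEquiv.refl _
  | cons n ns ih => exact (wordEquiv_starMove n l).trans (ih _)

end Star

/-! ### Folding a star onto a root system of rank two -/

section Fold

variable {V : Type*} [AddCommGroup V] [Module ℝ V] [TopologicalSpace V]
  [IsTopologicalAddGroup V] [ContinuousSMul ℝ V] [T2Space V] [FiniteDimensional ℝ V]
  {T : ℝ} [hT : Fact (0 < T)] {k : ℕ}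

/-- The nodes of the star above the two nodes of a diagram of rank two: the leaves above `true`,
the centre above `false`. -/
def starFiber (k : ℕ) : Bool → List (Fin (k + 1))
  | true => (List.finRange k).map Fin.succ
  | false => [0]

/-- The linear map with coordinate `c false` at the centre and `c true` at the leaves. -/
def starMap (k : ℕ) (c : Bool → Module.Dual ℝ V) : V →ₗ[ℝ] (Fin (k + 1) → ℝ) :=
  LinearMap.pi (Fin.cons (c false) fun _ => c true)

@[simp] theorem starMap_zero (c : Bool → Module.Dual ℝ V) (v : V) :
    starMap k c v 0 = c false v := rfl

@[simp] theorem starMap_succ (c : Bool → Module.Dual ℝ V) (v : V) (i : Fin k) :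
    starMap k c v i.succ = c true v := rfl

/-- The image of a path under `starMap`. -/
noncomputable def starPath (k : ℕ) (c : Bool → Module.Dual ℝ V) (γ : BasedPath V T) :
    BasedPath (Fin (k + 1) → ℝ) T where
  toMap := ⟨fun t => starMap k c (γ.toMap t),
    (LinearMap.continuous_of_finiteDimensional (starMap k c)).comp γ.toMap.continuous⟩
  map_start := by
    change starMap k c (γ.toMap (startTime T)) = 0
    rw [γ.map_start, map_zero]

theorem starPath_apply (c : Bool → Module.Dual ℝ V) (γ : BasedPath V T)
    (t : Set.Icc (0 : ℝ) T) : (starPath k c γ).toMap t = starMap k c (γ.toMap t) := rfl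

theorem height_starPath_zero (c : Bool → Module.Dual ℝ V) (γ : BasedPath V T) :
    height (starCoroot 0) (starPath k c γ) = height (c false) γ := rfl

theorem height_starPath_succ (c : Bool → Module.Dual ℝ V) (γ : BasedPath V T) (i : Fin k) :
    height (starCoroot i.succ) (starPath k c γ) = height (c true) γ := rfl

/-- Distinct leaves are orthogonal, so a transform at one leaf leaves the heights at the others
alone and every leaf subtracts the same running infimum. The case `ls = []` is separate because the
empty word imposes no condition. -/
theorem height_pitWord_leaves (c : Bool → Module.Dual ℝ V) (γ : BasedPath V T)
    {ls : List (Fin k)} (hls : ls.Nodup) :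
    (∀ j ∉ ls, height (starCoroot j.succ)
        (pitWord starRoot starCoroot (ls.map Fin.succ) (starPath k c γ)) = height (c true) γ) ∧
      (∀ t, (pitWord starRoot starCoroot (ls.map Fin.succ) (starPath k c γ)).toMap t =
        starMap k c (γ.toMap t) -
          runInf (height (c true) γ) t • (ls.map fun j => starRoot j.succ).sum) ∧
      (IntWord starRoot starCoroot (ls.map Fin.succ) (starPath k c γ) ↔
        (ls = [] ∨ ∃ n : ℤ, minHeight (c true) γ = n)) := by
  induction ls with
  | nil => simp [starPath_apply, height_starPath_succ]
  | cons i ls ih =>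
    obtain ⟨hi, hls⟩ := List.nodup_cons.mp hls
    obtain ⟨ih1, ih2, ih3⟩ := ih hls
    refine ⟨fun j hj => ?_, fun t => ?_, ?_⟩
    · have hji : j ≠ i := fun h => hj (h ▸ List.mem_cons_self)
      rw [← ih1 j fun h => hj (List.mem_cons_of_mem _ h), List.map_cons, pitWord_cons,
        height_pitman_eq, starCoroot_starRoot]
      simp [starCartan, hji]
    · rw [List.map_cons, pitWord_cons, pitman_apply, ih2, ih1 i hi, List.map_cons, List.sum_cons]
      module
    · rw [List.map_cons, intWord_cons, ih3, minHeight_eq_runInf, ih1 i hi, ← minHeight_eq_runInf]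
      simp only [reduceCtorEq, false_or]
      tauto

variable {α : Bool → V} {c : Bool → Module.Dual ℝ V}

theorem sum_starRoot_leaves (h1 : c true (α true) = 2) (h2 : c false (α true) = -k) :
    ((List.finRange k).map fun j => starRoot j.succ).sum = starMap k c (α true) := by
  rw [← List.ofFn_eq_map, List.sum_ofFn]
  funext i
  rw [Finset.sum_apply]
  refine Fin.cases ?_ (fun i => ?_) i
  · simp [starRoot, starCartan, h2, (Fin.succ_ne_zero _).symm]
  · simp [starRoot, starCartan, h1]

theorem starRoot_center (h1 : c false (α false) = 2) (h2 : c true (α false) = -1) :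
    starRoot 0 = starMap k c (α false) := by
  funext i
  refine Fin.cases ?_ (fun i => ?_) i
  · simp [starRoot, starCartan, h1]
  · simp [starRoot, starCartan, h2]

variable (hc : ∀ x, c x (α x) = 2) (h1 : c true (α false) = -1) (h2 : c false (α true) = -k)
  (hk : k ≠ 0)

include hc h1 h2 hk

/-- Folding: the centre root is the image of `α false` and the leaf roots add up to the image of `α
true`, so one Pitman transform in rank two becomes the product over a fibre of the star. -/
theorem pitWord_starFiber (x : Bool) (γ : BasedPath V T) :
    pitWord starRoot starCoroot (starFiber k x) (starPath k c γ) =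
        starPath k c (pitman (α x) (c x) γ) ∧
      (IntWord starRoot starCoroot (starFiber k x) (starPath k c γ) ↔
        ∃ n : ℤ, minHeight (c x) γ = n) := by
  cases x with
  | false =>
    refine ⟨?_, ?_⟩
    · ext t : 3
      simp only [starFiber, pitWord_cons, pitWord_nil, pitman_apply, starPath_apply, map_sub,
        map_smul, height_starPath_zero, starRoot_center (k := k) (hc false) h1]
    · simp only [starFiber, intWord_cons, intWord_nil, pitWord_nil, minHeight_eq_runInf,
        height_starPath_zero, and_true]
  | true =>
    obtain ⟨-, e2, e3⟩ := height_pitWord_leaves c γ (List.nodup_finRange k)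
    refine ⟨?_, ?_⟩
    · ext t : 3
      rw [starFiber, e2, starPath_apply, pitman_apply, map_sub, map_smul,
        sum_starRoot_leaves (hc true) h2]
    · rw [starFiber, e3]
      simp [hk]

theorem pitWord_flatMap_starFiber (w : List Bool) (γ : BasedPath V T) :
    pitWord starRoot starCoroot (w.flatMap (starFiber k)) (starPath k c γ) =
        starPath k c (pitWord α c w γ) ∧
      (IntWord starRoot starCoroot (w.flatMap (starFiber k)) (starPath k c γ) ↔
        IntWord α c w γ) := by
  induction w with
  | nil => simp
  | cons x w ih =>
    obtain ⟨ih1, ih2⟩ := ih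
    obtain ⟨e1, e2⟩ := pitWord_starFiber hc h1 h2 hk x (pitWord α c w γ)
    rw [List.flatMap_cons, pitWord_append, intWord_append, ih1, ih2, e1, e2]
    exact ⟨rfl, Iff.rfl⟩

-- Pitman transforms move a path only inside the span of the two roots. There `starMap` is injective
-- when $0<k<4$, which allows identities to descend from the star.
omit hc h1 h2 hk in
theorem exists_pitWord_eq_add (w : List Bool) (γ : BasedPath V T) (t : Set.Icc (0 : ℝ) T) :
    ∃ p q : ℝ, (pitWord α c w γ).toMap t = γ.toMap t + p • α true + q • α false := by
  induction w with
  | nil => exact ⟨0, 0, by simp⟩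
  | cons x w ih =>
    obtain ⟨p, q, h⟩ := ih
    rw [pitWord_cons, pitman_apply, h]
    cases x with
    | false => exact ⟨p, q - runInf (height (c false) (pitWord α c w γ)) t, by module⟩
    | true => exact ⟨p - runInf (height (c true) (pitWord α c w γ)) t, q, by module⟩

theorem wordEquiv_of_starFiber (hk4 : k < 4) {w w' : List Bool}
    (h : WordEquiv T starRoot starCoroot (w.flatMap (starFiber k)) (w'.flatMap (starFiber k))) :
    WordEquiv T α c w w' := by
  intro γ
  obtain ⟨e1, e2⟩ := pitWord_flatMap_starFiber hc h1 h2 hk w γ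
  obtain ⟨e3, e4⟩ := pitWord_flatMap_starFiber hc h1 h2 hk w' γ
  obtain ⟨h3, h4⟩ := h (starPath k c γ)
  refine ⟨?_, e2.symm.trans (h4.trans e4)⟩
  rw [e1, e3] at h3
  ext t
  have h5 : starMap k c ((pitWord α c w γ).toMap t) = starMap k c ((pitWord α c w' γ).toMap t) :=
    congrArg (fun p => p.toMap t) h3
  obtain ⟨p, q, hpq⟩ := exists_pitWord_eq_add (α := α) (c := c) w γ t
  obtain ⟨p', q', hpq'⟩ := exists_pitWord_eq_add (α := α) (c := c) w' γ t
  rw [hpq, hpq'] at h5 ⊢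
  have h6 := congrFun h5 0
  have h7 := congrFun h5 (Fin.succ ⟨0, Nat.pos_of_ne_zero hk⟩)
  simp only [starMap_zero, starMap_succ, map_add, map_smul, smul_eq_mul, hc, h1, h2] at h6 h7
  have hk4' : (k : ℝ) < 4 := by exact_mod_cast hk4
  -- $4-k$ is the determinant of the rank-two Cartan matrix.
  have hp : p = p' := by
    have : (4 - (k : ℝ)) * (p - p') = 0 := by linear_combination 2 * h7 + h6
    rcases mul_eq_zero.mp this with h | h <;> linarith
  have hq : q = q' := by rw [hp] at h7; linarith
  rw [hp, hq]

end Fold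

/-! ### Braid relations -/

section AltWord

variable {J K : Type*}

/-- The word of length `n` in the alternating letters `i` and `j`, with last letter `i`. -/
def altWord : J → J → ℕ → List J
  | _, _, 0 => []
  | i, j, n + 1 => altWord j i n ++ [i]

theorem map_altWord (φ : J → K) (i j : J) (n : ℕ) :
    (altWord i j n).map φ = altWord (φ i) (φ j) n := by
  induction n generalizing i j with
  | zero => rfl
  | succ n ih => simp [altWord, ih]

theorem length_altWord (i j : J) (n : ℕ) : (altWord i j n).length = n := by
  induction n generalizing i j with
  | zero => rfl
  | succ n ih => simp [altWord, ih]

/-- The order of the product of two simple reflections, in terms of the product of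
the two Cartan integers. -/
def braidLength (n : ℤ) : ℕ := if n = 0 then 2 else if n = 1 then 3 else if n = 2 then 4 else 6

/-- The pairs of Cartan integers of two distinct simple roots. -/
def IsCartanPair (p q : ℤ) : Prop :=
  (p = 0 ∧ q = 0) ∨ (p = -1 ∧ (q = -1 ∨ q = -2 ∨ q = -3)) ∨ (q = -1 ∧ (p = -2 ∨ p = -3))

variable {V : Type*} [AddCommGroup V] [Module ℝ V] [TopologicalSpace V]
  [IsTopologicalAddGroup V] [ContinuousSMul ℝ V] [T2Space V] [FiniteDimensional ℝ V]
  {T : ℝ} [hT : Fact (0 < T)]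

/-- The stars with one, two and three leaves are $A_2$, $A_3$ and $D_4$, folding onto $A_2$, $B_2$
and $G_2$. The numbers are the positions of successive commutation or braid moves that turn one
unfolded alternating word into the other; evaluating `starMove` checks this. -/
theorem wordEquiv_altWord_bool {α : Bool → V} {c : Bool → Module.Dual ℝ V}
    (hc : ∀ x, c x (α x) = 2) {q : ℤ} (hq : q = -1 ∨ q = -2 ∨ q = -3)
    (h1 : c true (α false) = -1) (h2 : c false (α true) = q) :
    WordEquiv T α c (altWord false true (braidLength (-q)))
      (altWord true false (braidLength (-q))) := by
  rcases hq with rfl | rfl | rfl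
  · exact wordEquiv_of_starFiber (k := 1) hc h1 (by rw [h2]; norm_num) (by norm_num) (by norm_num)
      (wordEquiv_foldl_starMove [0] _)
  · exact wordEquiv_of_starFiber (k := 2) hc h1 (by rw [h2]; norm_num) (by norm_num) (by norm_num)
      (wordEquiv_foldl_starMove [0, 1, 3, 2, 0, 2, 1] _)
  · exact wordEquiv_of_starFiber (k := 3) hc h1 (by rw [h2]; norm_num) (by norm_num) (by norm_num)
      (wordEquiv_foldl_starMove [4, 5, 4, 2, 6, 4, 3, 1, 3, 6, 5, 7, 9, 8, 6, 4, 3, 2, 0, 6, 4, 2,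
        4, 8, 7, 5, 3, 5, 7, 6, 5] _)

theorem wordEquiv_altWord {α : J → V} {c : J → Module.Dual ℝ V} {i j : J}
    (hi : c i (α i) = 2) (hj : c j (α j) = 2) {p q : ℤ} (hpq : IsCartanPair p q)
    (hij : c i (α j) = p) (hji : c j (α i) = q) :
    WordEquiv T α c (altWord i j (braidLength (p * q))) (altWord j i (braidLength (p * q))) := by
  have key : ∀ {i j : J} (_ : c i (α i) = 2) (_ : c j (α j) = 2) {q : ℤ}
      (_ : q = -1 ∨ q = -2 ∨ q = -3) (_ : c i (α j) = -1) (_ : c j (α i) = q),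
      WordEquiv T α c (altWord i j (braidLength (-q))) (altWord j i (braidLength (-q))) := by
    intro i j hi hj q hq hij hji
    have h := wordEquiv_altWord_bool (T := T)
      (α := α ∘ fun x : Bool => if x then i else j) (c := c ∘ fun x : Bool => if x then i else j)
      (by rintro (_ | _) <;> simp [hi, hj]) hq (by simpa using hij) (by simpa using hji)
    simpa [map_altWord] using (h.map (fun x : Bool => if x then i else j)).symm
  rcases hpq with ⟨rfl, rfl⟩ | ⟨rfl, hq⟩ | ⟨rfl, hp⟩
  · exact WordEquiv.swap (by simpa using hji) (by simpa using hij)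
  · simpa using key hi hj hq (by simpa using hij) hji
  · simpa using (key hj hi (Or.inr hp) (by simpa using hji) hij).symm

end AltWord

/-! ### Reduced words in the Weyl group -/

section Weyl

open RootPairing

variable {ι V N : Type*} [AddCommGroup V] [Module ℝ V] [AddCommGroup N] [Module ℝ N]
  {P : RootPairing ι ℝ V N} {b : P.Base}

theorem weylGroup_ext {g h : P.weylGroup} (H : ∀ v : V, g • v = h • v) : g = h :=
  Subtype.ext (Equiv.weightHom_injective P (LinearEquiv.ext H))

theorem ofIdx_smul_eq (i : ι) (v : V) :
    weylGroup.ofIdx P i • v = v - P.coroot' i v • P.root i := by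
  rw [weylGroup.ofIdx_smul, Equiv.reflection_smul, reflection_apply]

theorem ofIdx_mul_self (i : ι) : weylGroup.ofIdx P i * weylGroup.ofIdx P i = 1 :=
  weylGroup_ext fun v => by simp [mul_smul]

theorem weylGroupToPerm_ofIdx (i j : ι) :
    P.weylGroupToPerm (weylGroup.ofIdx P i) j = P.reflectionPerm i j := rfl

theorem weylGroup_smul_smul (g : P.weylGroup) (r : ℝ) (v : V) : g • (r • v) = r • (g • v) :=
  (Equiv.weightHom P g).map_smul r v

@[simp] theorem wordProd_nil : wordProd b [] = 1 := rfl

@[simp] theorem wordProd_cons (i : b.support) (l : List b.support) :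
    wordProd b (i :: l) = weylGroup.ofIdx P i * wordProd b l := rfl

theorem wordProd_append (l l' : List b.support) :
    wordProd b (l ++ l') = wordProd b l * wordProd b l' := by
  simp [wordProd]

theorem coroot'_weylGroupToPerm (l : List b.support) (i : ι) (v : V) :
    P.coroot' (P.weylGroupToPerm (wordProd b l) i) (wordProd b l • v) = P.coroot' i v := by
  induction l with
  | nil => simp
  | cons j l ih =>
    rw [wordProd_cons, map_mul, Equiv.Perm.mul_apply, weylGroupToPerm_ofIdx, mul_smul,
      weylGroup.ofIdx_smul, Equiv.reflection_smul, coroot'_reflection, ← ih]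
    simp

/-- Conjugation of a reflection by an element of the Weyl group. -/
theorem wordProd_mul_ofIdx (l : List b.support) (i : ι) :
    wordProd b l * weylGroup.ofIdx P i =
      weylGroup.ofIdx P (P.weylGroupToPerm (wordProd b l) i) * wordProd b l := by
  refine weylGroup_ext fun v => ?_
  rw [mul_smul, mul_smul, ofIdx_smul_eq, ofIdx_smul_eq, coroot'_weylGroupToPerm, smul_sub,
    weylGroup_smul_smul, weylGroup_apply_root]

/-! ### Reduced words, the exchange property and the longest element. -/

theorem exists_isReducedWord (l : List b.support) :
    ∃ l', IsReducedWord b l' (wordProd b l) ∧ l'.length ≤ l.length := by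
  classical
  have hex : ∃ n, ∃ l' : List b.support, wordProd b l' = wordProd b l ∧ l'.length = n :=
    ⟨_, l, rfl, rfl⟩
  obtain ⟨l', h1, h2⟩ := Nat.find_spec hex
  exact ⟨l', ⟨h1, fun l'' h => h2.trans_le (Nat.find_min' hex ⟨l'', h, rfl⟩)⟩,
    h2.trans_le (Nat.find_min' hex ⟨l, rfl, rfl⟩)⟩

theorem IsReducedWord.of_append {l q : List b.support} {w : P.weylGroup}
    (h : IsReducedWord b (l ++ q) w) : IsReducedWord b l (wordProd b l) := by
  refine ⟨rfl, fun l' hl' => ?_⟩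
  have := h.2 (l' ++ q) (by rw [wordProd_append, hl', ← wordProd_append, h.1])
  simp only [List.length_append] at this
  omega

theorem IsReducedWord.weylLength_eq {l : List b.support} {w : P.weylGroup}
    (h : IsReducedWord b l w) : weylLength b w = l.length := by
  refine le_antisymm (Nat.sInf_le ⟨l, h.1, rfl⟩) (le_csInf ⟨_, l, h.1, rfl⟩ ?_)
  rintro _ ⟨l', hl', rfl⟩
  exact h.2 l' hl'

/-- $ws_i\alpha_i=-w\alpha_i$. -/
theorem isPos_reflectionPerm_iff_not [P.IsCrystallographic] (w : P.weylGroup) (i : ι) :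
    b.IsPos (P.weylGroupToPerm (w * weylGroup.ofIdx P i) i) ↔ ¬ b.IsPos (P.weylGroupToPerm w i) := by
  let := P.indexNeg
  rw [← RootPairing.Base.IsPos.neg_iff_not]
  suffices h : P.weylGroupToPerm (w * weylGroup.ofIdx P i) i = -(P.weylGroupToPerm w i) by rw [h]
  apply P.root.injective
  rw [← weylGroup_apply_root, mul_smul, ofIdx_smul_eq, indexNeg_neg, root_reflectionPerm, reflection_apply_self,
    ← weylGroup_apply_root]
  simp [two_smul]

variable [Finite ι] [P.IsCrystallographic] [P.IsReduced]

/-- The exchange property. -/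
theorem exists_wordProd_eq_mul_ofIdx (l : List b.support) (i : b.support)
    (h : ¬ b.IsPos (P.weylGroupToPerm (wordProd b l) i)) :
    ∃ l' : List b.support, wordProd b l' = wordProd b l * weylGroup.ofIdx P i ∧
      l'.length + 1 = l.length := by
  induction l with
  | nil => exact absurd (RootPairing.Base.isPos_of_mem_support i.2) (by simpa using h)
  | cons j l ih =>
    by_cases hl : b.IsPos (P.weylGroupToPerm (wordProd b l) i)
    · refine ⟨l, ?_, rfl⟩
      -- $s_j$ permutes the positive roots other than $\alpha_j$, so the root turned negative by
      -- $s_j$ must be $\alpha_j$. Conjugation then moves $s_i$ across the tail as $s_j$, which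
      -- cancels the first letter.
      have hj : P.weylGroupToPerm (wordProd b l) i = j := by
        by_contra hne
        apply h
        rw [wordProd_cons, map_mul, Equiv.Perm.mul_apply, weylGroupToPerm_ofIdx]
        exact hl.reflectionPerm j.2 hne
      rw [wordProd_cons, mul_assoc, wordProd_mul_ofIdx, hj, ← mul_assoc, ofIdx_mul_self, one_mul]
    · obtain ⟨l', h1, h2⟩ := ih hl
      exact ⟨j :: l', by rw [wordProd_cons, h1, wordProd_cons, mul_assoc], by simp [h2]⟩

theorem IsReducedWord.exists_append {l : List b.support} {w : P.weylGroup}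
    (h : IsReducedWord b l w) {i : b.support} (hi : ¬ b.IsPos (P.weylGroupToPerm w i)) :
    ∃ l', IsReducedWord b (l' ++ [i]) w := by
  obtain ⟨rfl, h2⟩ := h
  obtain ⟨l', h3, h4⟩ := exists_wordProd_eq_mul_ofIdx l i hi
  refine ⟨l', ?_, fun l'' h5 => ?_⟩
  · simp [wordProd_append, h3, mul_assoc, ofIdx_mul_self]
  · simpa [h4] using h2 l'' h5

theorem IsReducedWord.not_isPos {l : List b.support} {i : b.support} {w : P.weylGroup}
    (h : IsReducedWord b (l ++ [i]) w) : ¬ b.IsPos (P.weylGroupToPerm w i) := by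
  obtain ⟨rfl, h2⟩ := h
  intro hpos
  have hw : wordProd b (l ++ [i]) = wordProd b l * weylGroup.ofIdx P i := by
    simp [wordProd_append]
  rw [hw, isPos_reflectionPerm_iff_not] at hpos
  obtain ⟨l', h3, h4⟩ := exists_wordProd_eq_mul_ofIdx l i hpos
  have := h2 l' (by rw [h3, hw])
  simp only [List.length_append, List.length_singleton] at this
  omega

/-- If $w\alpha_i$ were positive, $ws_i$ would send $\alpha_i$ to a negative root and have a reduced
word ending in $i$. Deleting that letter leaves a word for $w$, so $ws_i$ would be longer than $w$.
-/
theorem IsLongest.not_isPos {l : List b.support} {w : P.weylGroup} (hw : IsLongest b w)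
    (hl : IsReducedWord b l w) (i : b.support) : ¬ b.IsPos (P.weylGroupToPerm w i) := by
  intro hpos
  have hw' : wordProd b (l ++ [i]) = w * weylGroup.ofIdx P i := by
    simp [wordProd_append, hl.1]
  obtain ⟨l', h1, -⟩ := exists_isReducedWord (l ++ [i])
  have h2 := hw (wordProd b (l ++ [i]))
  rw [h1.weylLength_eq, hl.weylLength_eq] at h2
  obtain ⟨l'', h3⟩ := h1.exists_append (i := i) (by
    rw [hw', isPos_reflectionPerm_iff_not]
    exact not_not.mpr hpos)
  have h4 := h3.2 l' h1.1
  have h5 := h1.2 _ h3.1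
  have h6 : wordProd b l'' = w := by
    have := h3.1
    rw [wordProd_append, hw'] at this
    simpa using this
  have h7 := hl.2 l'' h6
  simp only [List.length_append, List.length_singleton] at h4 h5
  omega

/-! ### Matsumoto's theorem -/

/-- Makes the height linear, so that signs of roots can be read off linear relations. The form is
extended from the span of the simple roots, which may be smaller than `V`. -/
theorem exists_dual_eq_height (b : P.Base) :
    ∃ h : Module.Dual ℝ V, ∀ i, h (P.root i) = b.height i := by
  have hli : LinearIndependent ℝ fun i : b.support => P.root i := b.linearIndepOn_root
  obtain ⟨h, hh⟩ := LinearMap.exists_extend ((Module.Basis.span hli).constr ℝ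
    fun _ => (1 : ℝ))
  have h1 : ∀ i ∈ b.support, h (P.root i) = 1 := by
    intro i hi
    have e := (Module.Basis.span hli).constr_basis ℝ (fun _ => (1 : ℝ)) ⟨i, hi⟩
    rw [← hh] at e
    rwa [LinearMap.comp_apply, Submodule.subtype_apply, Module.Basis.span_apply] at e
  refine ⟨h, fun i => ?_⟩
  obtain ⟨f, -, -, hf⟩ := b.exists_root_eq_sum_int i
  rw [RootPairing.Base.height_eq_sum hf, hf, map_sum, Int.cast_sum]
  refine Finset.sum_congr rfl fun j hj => ?_
  rw [map_zsmul, h1 j hj]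
  simp

/-- The length of the braid relation between two simple reflections. -/
noncomputable def simpleBraidLength (b : P.Base) (i j : b.support) : ℕ :=
  braidLength (P.pairingIn ℤ j i * P.pairingIn ℤ i j)

theorem isCartanPair_pairingIn {i j : b.support} (hij : i ≠ j) :
    IsCartanPair (P.pairingIn ℤ j i) (P.pairingIn ℤ i j) := by
  have hij' : (i : ι) ≠ j := fun h => hij (Subtype.ext h)
  have h1 := P.pairingIn_pairingIn_mem_set_of_isCrystal_of_isRed' (j : ι) (i : ι)
    (fun h => hij' (P.root.injective h).symm) (b.root_ne_neg_of_ne j.2 i.2 hij'.symm)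
  have h2 := b.pairingIn_le_zero_of_ne hij' i.2 j.2
  have h3 := b.pairingIn_le_zero_of_ne hij'.symm j.2 i.2
  simp only [Set.mem_insert_iff, Set.mem_singleton_iff, Prod.mk.injEq] at h1
  unfold IsCartanPair
  omega

theorem coroot'_root_eq (i j : ι) : P.coroot' i (P.root j) = P.pairingIn ℤ j i := by
  rw [root_coroot'_eq_pairing, ← P.algebraMap_pairingIn ℤ]
  simp

/-- The letter by which an alternating word is extended on the left. -/
def altLetter {J : Type*} : J → J → ℕ → J
  | i, _, 0 => i
  | i, j, n + 1 => altLetter j i n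

theorem altWord_succ {J : Type*} (i j : J) (n : ℕ) :
    altWord i j (n + 1) = altLetter i j n :: altWord i j n := by
  induction n generalizing i j with
  | zero => rfl
  | succ n ih => rw [altWord, ih, altWord, altLetter, List.cons_append]

/-- The coefficients of the positive roots of a root system of rank two. -/
def altCoef : ℤ → ℤ → ℕ → ℤ × ℤ
  | _, _, 0 => (1, 0)
  | p, q, n + 1 => (-p * (altCoef q p n).1 - (altCoef q p n).2, (altCoef q p n).1)

theorem altCoef_nonneg {p q : ℤ} (hpq : IsCartanPair p q) {n : ℕ} (hn : n < braidLength (p * q)) :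
    0 ≤ (altCoef p q n).1 ∧ 0 ≤ (altCoef p q n).2 := by
  rcases hpq with ⟨rfl, rfl⟩ | ⟨rfl, rfl | rfl | rfl⟩ | ⟨rfl, rfl | rfl⟩ <;>
    revert n <;> decide

theorem inv_altWord_smul_root (i j : b.support) (n : ℕ) :
    (wordProd b (altWord i j n))⁻¹ • P.root (altLetter i j n : b.support) =
      ((altCoef (P.pairingIn ℤ j i) (P.pairingIn ℤ i j) n).1 : ℝ) • P.root i +
        ((altCoef (P.pairingIn ℤ j i) (P.pairingIn ℤ i j) n).2 : ℝ) • P.root j := by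
  induction n generalizing i j with
  | zero => simp [altWord, altLetter, altCoef]
  | succ n ih =>
    have hinv : (weylGroup.ofIdx P (i : ι))⁻¹ = weylGroup.ofIdx P i :=
      inv_eq_of_mul_eq_one_left (ofIdx_mul_self _)
    have h1 : wordProd b [i] = weylGroup.ofIdx P i := by simp
    rw [altWord, altLetter, wordProd_append, mul_inv_rev, mul_smul, ih, h1, hinv, ofIdx_smul_eq,
      map_add, map_smul, map_smul, coroot'_root_eq, coroot'_root_eq, pairingIn_same, altCoef]
    push_cast
    simp only [smul_eq_mul]
    module

/-- Both sides are evaluated on an arbitrary vector for each possible pair of Cartan integers. -/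
theorem wordProd_altWord (i j : b.support) (hij : i ≠ j) :
    wordProd b (altWord i j (simpleBraidLength b i j)) =
      wordProd b (altWord j i (simpleBraidLength b i j)) := by
  have h1 := coroot'_root_eq (P := P) (i : ι) j
  have h2 := coroot'_root_eq (P := P) (j : ι) i
  have h3 : P.coroot' i (P.root i) = 2 := P.root_coroot_two i
  have h4 : P.coroot' j (P.root j) = 2 := P.root_coroot_two j
  have hpq := isCartanPair_pairingIn hij
  unfold simpleBraidLength
  refine weylGroup_ext fun v => ?_
  generalize P.pairingIn ℤ (j : ι) i = p at *
  generalize P.pairingIn ℤ (i : ι) j = q at *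
  rcases hpq with ⟨rfl, rfl⟩ | ⟨rfl, rfl | rfl | rfl⟩ | ⟨rfl, rfl | rfl⟩ <;>
  · push_cast at h1 h2
    simp only [braidLength, altWord, mul_zero, mul_one, mul_neg, neg_neg, neg_mul, one_mul,
      if_true, if_false, OfNat.ofNat_ne_zero, OfNat.ofNat_ne_one, one_ne_zero, List.nil_append,
      List.cons_append, Int.reduceEq, wordProd_cons, wordProd_nil, mul_smul,
      ofIdx_smul_eq, map_sub, map_smul, smul_eq_mul, h1, h2, h3, h4]
    module

/-- The alternating suffix $u$ grows on its left. If $w=w'u$, then $u^{-1}$ sends the root of the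
next letter to a nonnegative combination of $\alpha_i$ and $\alpha_j$, both made negative by $w$.
Hence $w'$ makes that root negative, and exchange gives $w'$ a reduced word ending in that letter.
-/
theorem IsReducedWord.exists_append_altWord {l : List b.support} {w : P.weylGroup}
    (h : IsReducedWord b l w) {i j : b.support} (hij : i ≠ j)
    (hi : ¬ b.IsPos (P.weylGroupToPerm w i)) (hj : ¬ b.IsPos (P.weylGroupToPerm w j)) {n : ℕ}
    (hn : n ≤ simpleBraidLength b i j) : ∃ l', IsReducedWord b (l' ++ altWord i j n) w := by
  induction n with
  | zero => exact ⟨l, by simpa [altWord] using h⟩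
  | succ n ih =>
    obtain ⟨l', hl'⟩ := ih (by omega)
    have hw : wordProd b l' = w * (wordProd b (altWord i j n))⁻¹ := by
      rw [← hl'.1, wordProd_append, mul_inv_cancel_right]
    have hneg : ¬ b.IsPos (P.weylGroupToPerm (wordProd b l') (altLetter i j n : b.support)) := by
      obtain ⟨ht, hht⟩ := exists_dual_eq_height b
      have e := hht (P.weylGroupToPerm (wordProd b l') (altLetter i j n : b.support))
      rw [← weylGroup_apply_root, hw, mul_smul, inv_altWord_smul_root, smul_add,
        weylGroup_smul_smul, weylGroup_smul_smul, weylGroup_apply_root, weylGroup_apply_root,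
        map_add, map_smul, map_smul, hht, hht, ← hw] at e
      rw [RootPairing.Base.isPos_iff, not_lt] at hi hj ⊢
      obtain ⟨h1, h2⟩ := altCoef_nonneg (isCartanPair_pairingIn hij) hn
      rw [smul_eq_mul, smul_eq_mul] at e
      norm_cast at e
      rw [← e]
      exact add_nonpos (mul_nonpos_of_nonneg_of_nonpos h1 hi)
        (mul_nonpos_of_nonneg_of_nonpos h2 hj)
    obtain ⟨l'', hl''⟩ := hl'.of_append.exists_append hneg
    refine ⟨l'', ?_, fun m hm => ?_⟩
    · rw [altWord_succ, ← List.singleton_append, ← List.append_assoc, wordProd_append, hl''.1,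
        ← wordProd_append, hl'.1]
    · have h1 := hl'.2 m hm
      have h2 := hl''.2 l' rfl
      simp only [List.length_append, length_altWord, List.length_singleton] at h1 h2 ⊢
      omega

/-- Matsumoto's theorem: two reduced words of the same element are related by every equivalence
relation that contains the braid relations and is compatible with appending letters. -/
theorem IsReducedWord.rel {R : List b.support → List b.support → Prop}
    (hR : Equivalence R) (happ : ∀ l l' i, R l l' → R (l ++ [i]) (l' ++ [i]))
    (hbraid : ∀ l i j, i ≠ j → R (l ++ altWord i j (simpleBraidLength b i j))
      (l ++ altWord j i (simpleBraidLength b i j)))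
    {l l' : List b.support} {w : P.weylGroup} (h : IsReducedWord b l w)
    (h' : IsReducedWord b l' w) : R l l' := by
  induction hn : l.length generalizing l l' w with
  | zero =>
    have : l'.length = 0 := Nat.le_zero.mp ((h'.2 l h.1).trans_eq hn)
    rw [List.length_eq_zero_iff.mp hn, List.length_eq_zero_iff.mp this]
    exact hR.refl _
  | succ n ih =>
    -- Two reduced words with the same last letter are related by induction on the length.
    have key : ∀ {m m' : List b.support} {i : b.support}, IsReducedWord b (m ++ [i]) w →
        IsReducedWord b (m' ++ [i]) w → R (m ++ [i]) (m' ++ [i]) := by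
      intro m m' i hm hm'
      have e : wordProd b m' = wordProd b m := by
        have := hm.1.trans hm'.1.symm
        simpa [wordProd_append] using this.symm
      refine happ _ _ _ (ih hm.of_append (e ▸ hm'.of_append) ?_)
      have h1 := hm.2 l h.1
      have h2 := h.2 _ hm.1
      simp only [List.length_append, List.length_singleton] at h1 h2
      omega
    have hlen : l'.length = n + 1 := le_antisymm (hn ▸ h'.2 l h.1) (hn ▸ h.2 l' h'.1)
    obtain ⟨m, i, rfl⟩ := List.eq_nil_or_concat' l |>.resolve_left (by rintro rfl; simp at hn)
    obtain ⟨m', j, rfl⟩ := List.eq_nil_or_concat' l' |>.resolve_left (by rintro rfl; simp at hlen)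
    by_cases hij : i = j
    · subst hij
      exact key h h'
    -- Both sides of the braid relation are suffixes of reduced words of `w`. One of these words
    -- shares its last letter with each given word, and the braid relation joins the two.
    obtain ⟨u, hu⟩ := h.exists_append_altWord hij h.not_isPos h'.not_isPos le_rfl
    have hu' : IsReducedWord b (u ++ altWord j i (simpleBraidLength b i j)) w := by
      refine ⟨?_, fun m hm => ?_⟩
      · rw [wordProd_append, ← wordProd_altWord i j hij, ← wordProd_append, hu.1]
      · have := hu.2 m hm
        simp only [List.length_append, length_altWord] at this ⊢
        exact this
    have hb := hbraid u i j hij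
    obtain ⟨k, hk⟩ : ∃ k, simpleBraidLength b i j = k + 1 :=
      Nat.exists_eq_succ_of_ne_zero (by
        unfold simpleBraidLength braidLength
        split_ifs <;> norm_num)
    rw [hk, altWord, ← List.append_assoc] at hu hu'
    rw [hk, altWord, altWord, ← List.append_assoc, ← List.append_assoc] at hb
    exact hR.trans (key h hu) (hR.trans hb (key hu' h'))

end Weyl

/-! ### Generalized Littelmann operators -/

section Littelmann

variable {V : Type*} [AddCommGroup V] [Module ℝ V] [TopologicalSpace V]
  [IsTopologicalAddGroup V] [ContinuousSMul ℝ V] [T2Space V] [FiniteDimensional ℝ V]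
  {T : ℝ} [hT : Fact (0 < T)] {α : V} {c : Module.Dual ℝ V} {x : ℝ} {γ η : BasedPath V T}

theorem genLittelmann_eq_some_iff (hc : c α = 2) :
    genLittelmann hc x γ = some η ↔ InShiftRange c x γ ∧ IsShift α c x γ η := by
  unfold genLittelmann
  split_ifs with hx
  · have h := (existsUnique_isShift hc hx).choose_spec
    rw [Option.some_inj]
    exact ⟨fun e => ⟨hx, e ▸ h.1⟩, fun e => (h.2 η e.2).symm⟩
  · simp [hx]

theorem minHeight_le (c : Module.Dual ℝ V) (γ : BasedPath V T) (t : Set.Icc (0 : ℝ) T) :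
    minHeight c γ ≤ height c γ t := by
  rw [minHeight_eq]
  exact runningInf_le c γ (le_end t)

theorem minHeight_nonpos (c : Module.Dual ℝ V) (γ : BasedPath V T) : minHeight c γ ≤ 0 :=
  (minHeight_le c γ (startTime T)).trans_eq (height_start c γ)

/-- The endpoint height of the common Pitman transform is $c(\gamma(T))-2\min c(\gamma)$, so a rise
of the endpoint by $x$ forces a rise of the minimum by $x/2$. -/
theorem IsShift.minHeight_eq (hc : c α = 2) (h : IsShift α c x γ η) :
    minHeight c η = minHeight c γ + x / 2 := by
  have h1 := height_pitman hc η (endTime T)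
  have h2 := height_pitman hc γ (endTime T)
  rw [← PitmanPaths.minHeight_eq] at h1 h2
  rw [h.1, h2, h.2] at h1
  linarith

theorem genLittelmann_neg_of_eq_some (hc : c α = 2) (h : genLittelmann hc x γ = some η) :
    genLittelmann hc (-x) η = some γ := by
  rw [genLittelmann_eq_some_iff] at h ⊢
  obtain ⟨-, h2⟩ := h
  have h3 := h2.minHeight_eq hc
  have h4 := minHeight_le c γ (endTime T)
  have h5 := minHeight_nonpos c γ
  have h6 := h2.2
  exact ⟨⟨by linarith, by linarith⟩, h2.1.symm, by linarith⟩

theorem pitman_eq_self (h : minHeight c γ = 0) : pitman α c γ = γ := by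
  ext t
  have h1 : sInf (height c γ '' Set.Iic t) = 0 := by
    apply le_antisymm
    · exact (runningInf_le c γ (start_le t)).trans_eq (height_start c γ)
    · rw [minHeight_eq] at h
      exact h.symm.trans_le (runningInf_anti c γ (le_end t))
  change γ.toMap t - sInf (height c γ '' Set.Iic t) • α = _
  simp [h1]

end Littelmann

/-! ### The Littelmann module -/

section Module

open RootPairing

variable {ι V N : Type*} [AddCommGroup V] [Module ℝ V] [AddCommGroup N] [Module ℝ N]
  {P : RootPairing ι ℝ V N} {b : P.Base}
  [TopologicalSpace V] [IsTopologicalAddGroup V] [ContinuousSMul ℝ V] [T2Space V]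
  [FiniteDimensional ℝ V] {T : ℝ} [hT : Fact (0 < T)]

/-- The string parameters of a path along a word in the simple roots are integers. -/
def IntegralString (b : P.Base) (l : List b.support) (γ : BasedPath V T) : Prop :=
  IntWord (fun i : b.support => P.root i) (fun i : b.support => P.coroot' i) l γ

theorem pitmanWord_eq (l : List b.support) (γ : BasedPath V T) :
    pitmanWord b l γ =
      pitWord (fun i : b.support => P.root i) (fun i : b.support => P.coroot' i) l γ := rfl

theorem pitmanWord_append (l l' : List b.support) (γ : BasedPath V T) :
    pitmanWord b (l ++ l') γ = pitmanWord b l (pitmanWord b l' γ) :=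
  pitWord_append l l' γ

theorem integralString_append (l l' : List b.support) (γ : BasedPath V T) :
    IntegralString b (l ++ l') γ ↔ IntegralString b l (pitmanWord b l' γ) ∧ IntegralString b l' γ :=
  intWord_append l l' γ

theorem integralString_singleton (i : b.support) (γ : BasedPath V T) :
    IntegralString b [i] γ ↔ ∃ n : ℤ, minHeight (P.coroot' i) γ = n :=
  and_iff_left trivial

theorem littelmannStep_iff {μ ν : BasedPath V T} :
    LittelmannStep b μ ν ↔ ∃ i : b.support, ∃ x : ℝ, (x = 2 ∨ x = -2) ∧
      genLittelmann (coroot'_root_self (P := P) i) x μ = some ν := by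
  simp [LittelmannStep, littelmannE, littelmannF, or_and_right, exists_or]

theorem LittelmannStep.symm {μ ν : BasedPath V T} (h : LittelmannStep b μ ν) :
    LittelmannStep b ν μ := by
  rw [littelmannStep_iff] at h ⊢
  obtain ⟨i, x, hx, h⟩ := h
  exact ⟨i, -x, by rcases hx with rfl | rfl <;> simp, genLittelmann_neg_of_eq_some _ h⟩

theorem mem_littelmannModule_symm {μ ν : BasedPath V T} (h : ν ∈ littelmannModule b μ) :
    μ ∈ littelmannModule b ν := by
  induction h with
  | refl => exact Relation.ReflTransGen.refl
  | tail _ h ih => exact Relation.ReflTransGen.head h.symm ih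

theorem mem_littelmannModule_trans {γ μ ν : BasedPath V T} (h : μ ∈ littelmannModule b γ)
    (h' : ν ∈ littelmannModule b μ) : ν ∈ littelmannModule b γ :=
  Relation.ReflTransGen.trans h h'

/-- If the minimum is $-n$, each $e_i$ raises it by $1$ without changing $\mathcal P_{\alpha_i}$;
after $n$ steps the minimum is $0$ and the path equals its own transform. -/
theorem simplePitman_mem_littelmannModule {i : b.support} {γ : BasedPath V T}
    (h : ∃ n : ℤ, minHeight (P.coroot' i) γ = n) : simplePitman b i γ ∈ littelmannModule b γ := by
  have hc := coroot'_root_self (P := P) i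
  obtain ⟨n, hn⟩ : ∃ n : ℕ, minHeight (P.coroot' i) γ = -n := by
    obtain ⟨m, hm⟩ := h
    have h1 := minHeight_nonpos (P.coroot' i) γ
    rw [hm] at h1
    have h2 : m ≤ 0 := by exact_mod_cast h1
    refine ⟨(-m).toNat, ?_⟩
    rw [hm, ← Int.cast_natCast, Int.toNat_of_nonneg (by omega)]
    simp
  clear h
  induction n generalizing γ with
  | zero =>
    rw [simplePitman, pitman_eq_self (by simpa using hn)]
    exact Relation.ReflTransGen.refl
  | succ n ih =>
    have hr : InShiftRange (P.coroot' i) 2 γ := by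
      have := minHeight_le (P.coroot' i) γ (endTime T)
      refine ⟨by linarith, ?_⟩
      rw [hn]
      push_cast
      have : (0 : ℝ) ≤ n := n.cast_nonneg
      linarith
    obtain ⟨ν, hν, -⟩ := existsUnique_isShift hc hr
    have h1 : minHeight (P.coroot' i) ν = -n := by
      rw [hν.minHeight_eq hc, hn]
      push_cast
      ring
    have h2 := ih h1
    rw [simplePitman, hν.1] at h2
    exact Relation.ReflTransGen.head
      ⟨i, Or.inl ((genLittelmann_eq_some_iff hc).mpr ⟨hr, hν⟩)⟩ h2

theorem IsIntegralPath.pitmanWord_mem {γ : BasedPath V T} (h : IsIntegralPath b γ)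
    (l : List b.support) : pitmanWord b l γ ∈ littelmannModule b γ := by
  induction l with
  | nil => exact Relation.ReflTransGen.refl
  | cons i l ih =>
    exact mem_littelmannModule_trans ih
      (simplePitman_mem_littelmannModule ((h _ ih).2 i i.2))

theorem IsDominant.minHeight_eq_zero {π : BasedPath V T} (h : IsDominant b π) (i : b.support) :
    minHeight (P.coroot' i) π = 0 :=
  le_antisymm (minHeight_nonpos _ _)
    (le_csInf ⟨_, startTime T, rfl⟩ (by rintro _ ⟨t, rfl⟩; exact h i i.2 t))

theorem IsDominant.pitmanWord_eq_self {π : BasedPath V T} (h : IsDominant b π)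
    (l : List b.support) : pitmanWord b l π = π := by
  induction l with
  | nil => rfl
  | cons i l ih =>
    change simplePitman b i (pitmanWord b l π) = π
    rw [ih]
    exact pitman_eq_self (h.minHeight_eq_zero i)

theorem IsDominant.integralString {π : BasedPath V T} (h : IsDominant b π)
    (l : List b.support) : IntegralString b l π := by
  induction l with
  | nil => trivial
  | cons i l ih =>
    refine ⟨⟨0, ?_⟩, ih⟩
    rw [← pitmanWord_eq, h.pitmanWord_eq_self, h.minHeight_eq_zero, Int.cast_zero]

variable [Finite ι] [P.IsCrystallographic] [P.IsReduced]

/-- Each letter changes the endpoint by an integer multiple of a simple root, which is itself a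
weight. -/
theorem endpoint_mem_weightLattice {l : List b.support} {γ : BasedPath V T}
    (h : IntegralString b l γ) (h' : (pitmanWord b l γ).toMap (endTime T) ∈ weightLattice b) :
    γ.toMap (endTime T) ∈ weightLattice b := by
  induction l with
  | nil => exact h'
  | cons i l ih =>
    obtain ⟨⟨n, hn⟩, h⟩ := h
    refine ih h fun j hj => ?_
    obtain ⟨m, hm⟩ := h' j hj
    refine ⟨m + n * P.pairingIn ℤ (i : ι) j, ?_⟩
    change P.coroot' j ((pitman _ _ (pitmanWord b l γ)).toMap (endTime T)) = m at hm
    rw [← pitmanWord_eq, minHeight_eq_runInf] at hn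
    rw [pitman_apply, hn, map_sub, map_smul, coroot'_root_eq, smul_eq_mul] at hm
    push_cast
    linarith

theorem IsReducedWord.wordEquiv {l l' : List b.support} {w : P.weylGroup}
    (h : IsReducedWord b l w) (h' : IsReducedWord b l' w) :
    WordEquiv T (fun i : b.support => P.root i) (fun i : b.support => P.coroot' i) l l' := by
  refine h.rel ⟨WordEquiv.refl, WordEquiv.symm, WordEquiv.trans⟩
    (fun _ _ i hl => hl.append_right [i]) (fun l i j hij => ?_) h'
  exact (wordEquiv_altWord (T := T) (α := fun i : b.support => P.root i)
    (c := fun i : b.support => P.coroot' i) (coroot'_root_self _) (coroot'_root_self _)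
    (isCartanPair_pairingIn hij) (coroot'_root_eq _ _) (coroot'_root_eq _ _)).append_left l

/-! ### Invariance of $\mathcal P_{w_0}$ and of integral strings under the Littelmann operators. -/

variable {w₀ : P.weylGroup} (hw₀ : IsLongest b w₀) {l : List b.support}
  (hl : IsReducedWord b l w₀)

include hw₀ hl

/-- A reduced word of the longest element may be replaced by one with a given last letter. -/
theorem IsLongest.exists_append (i : b.support) :
    ∃ l' : List b.support, ∀ γ : BasedPath V T,
      pitmanWord b l γ = pitmanWord b l' (simplePitman b i γ) ∧
      (IntegralString b l γ ↔ IntegralString b l' (simplePitman b i γ) ∧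
        ∃ n : ℤ, minHeight (P.coroot' i) γ = n) := by
  obtain ⟨l', hl'⟩ := hl.exists_append (hw₀.not_isPos hl i)
  refine ⟨l', fun γ => ?_⟩
  obtain ⟨h1, h2⟩ := hl.wordEquiv hl' γ
  refine ⟨h1.trans (pitmanWord_append l' [i] γ), h2.trans ?_⟩
  rw [← integralString_singleton]
  exact integralString_append l' [i] γ

/-- For a step in direction $i$ a reduced word ending in $i$ is used: past its last letter the two
paths coincide. -/
theorem LittelmannStep.pitmanWord_eq {μ ν : BasedPath V T} (h : LittelmannStep b μ ν) :
    pitmanWord b l ν = pitmanWord b l μ ∧ (IntegralString b l μ → IntegralString b l ν) := by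
  rw [littelmannStep_iff] at h
  obtain ⟨i, x, hx, h⟩ := h
  have hs := ((genLittelmann_eq_some_iff _).mp h).2
  obtain ⟨l', hl'⟩ := IsLongest.exists_append (T := T) hw₀ hl i
  have hP : simplePitman b i ν = simplePitman b i μ := hs.1
  rw [(hl' ν).1, (hl' μ).1, (hl' ν).2, (hl' μ).2, hP]
  refine ⟨rfl, fun ⟨h1, n, hn⟩ => ⟨h1, ?_⟩⟩
  -- The one parameter that changes moves by $x/2=\pm1$.
  rw [hs.minHeight_eq (coroot'_root_self (P := P) i), hn]
  rcases hx with rfl | rfl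
  · exact ⟨n + 1, by norm_num⟩
  · exact ⟨n - 1, by push_cast; ring⟩

theorem pitmanWord_eq_of_mem_littelmannModule {μ ν : BasedPath V T}
    (h : ν ∈ littelmannModule b μ) :
    pitmanWord b l ν = pitmanWord b l μ ∧ (IntegralString b l μ → IntegralString b l ν) := by
  induction h with
  | refl => exact ⟨rfl, id⟩
  | tail _ h ih =>
    obtain ⟨h1, h2⟩ := h.pitmanWord_eq hw₀ hl
    exact ⟨h1.trans ih.1, fun h => h2 (ih.2 h)⟩

/-- The minimum for $\alpha_i$ is the first parameter met along a reduced word ending in $i$, and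
integrality does not depend on the word. -/
theorem hasIntegralMinima_of_integralString {γ : BasedPath V T} (h : IntegralString b l γ)
    (h' : (pitmanWord b l γ).toMap (endTime T) ∈ weightLattice b) : HasIntegralMinima b γ := by
  refine ⟨endpoint_mem_weightLattice h h', fun i hi => ?_⟩
  obtain ⟨l', hl'⟩ := IsLongest.exists_append (T := T) hw₀ hl ⟨i, hi⟩
  exact ((hl' γ).2.mp h).2

theorem isIntegralPath_of_isDominant {π η : BasedPath V T} (hdom : IsDominant b π)
    (hint : π.toMap (endTime T) ∈ weightLattice b) (hη : η ∈ littelmannModule b π) :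
    IsIntegralPath b η := by
  intro μ hμ
  obtain ⟨h1, h2⟩ := pitmanWord_eq_of_mem_littelmannModule hw₀ hl
    (mem_littelmannModule_trans hη hμ)
  refine hasIntegralMinima_of_integralString hw₀ hl (h2 (hdom.integralString l)) ?_
  rwa [h1, hdom.pitmanWord_eq_self]

end Module

end PitmanPaths

/-- For dominant `π` all the minima vanish, so `HasIntegralMinima` says no more than that the
endpoint is a weight. -/
theorem mainTheorem6 {ι V N : Type*} [Finite ι]
    [AddCommGroup V] [Module ℝ V] [FiniteDimensional ℝ V]
    [TopologicalSpace V] [IsTopologicalAddGroup V] [ContinuousSMul ℝ V] [T2Space V]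
    [AddCommGroup N] [Module ℝ N]
    (P : RootPairing ι ℝ V N) [P.IsCrystallographic] [P.IsReduced] (b : P.Base)
    (w₀ : P.weylGroup) (hw₀ : PitmanPaths.IsLongest b w₀)
    (l : List b.support) (hl : PitmanPaths.IsReducedWord b l w₀)
    (T : ℝ) [Fact (0 < T)]
    (π : PitmanPaths.BasedPath V T) (hdom : PitmanPaths.IsDominant b π)
    (hint : PitmanPaths.HasIntegralMinima b π) :
    (∀ η : PitmanPaths.BasedPath V T, η ∈ PitmanPaths.littelmannModule b π ↔
      PitmanPaths.IsIntegralPath b η ∧ PitmanPaths.pitmanWord b l η = π) ∧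
    (∀ η ∈ PitmanPaths.littelmannModule b π, ∀ μ : PitmanPaths.BasedPath V T,
      (μ ∈ PitmanPaths.littelmannModule b η ∧ PitmanPaths.IsDominant b μ) ↔
        μ = PitmanPaths.pitmanWord b l η) := by
  have key : ∀ η ∈ PitmanPaths.littelmannModule b π, PitmanPaths.pitmanWord b l η = π :=
    fun η hη => (PitmanPaths.pitmanWord_eq_of_mem_littelmannModule hw₀ hl hη).1.trans
      (hdom.pitmanWord_eq_self l)
  refine ⟨fun η => ⟨fun hη => ⟨?_, key η hη⟩, ?_⟩, fun η hη μ => ⟨?_, ?_⟩⟩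
  · exact PitmanPaths.isIntegralPath_of_isDominant hw₀ hl hdom hint.1 hη
  · rintro ⟨h1, rfl⟩
    exact PitmanPaths.mem_littelmannModule_symm (h1.pitmanWord_mem l)
  · rintro ⟨h1, h2⟩
    -- A dominant path in the module is its own image under $\mathcal P_{w_0}$, and that image is
    -- `π`.
    rw [key η hη, ← key μ (PitmanPaths.mem_littelmannModule_trans hη h1),
      h2.pitmanWord_eq_self]
  · rintro rfl
    rw [key η hη]
    exact ⟨PitmanPaths.mem_littelmannModule_symm hη, hdom⟩
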